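/- **Setting.** Let $P$ be a complex polynomial in two variables and let $\Gamma\subseteq\widehat{\mathbb C}\times\widehat{\mathbb C}$ be the algebraic curve $P(z,w)=0$ (holomorphic case) or $P(\overline z,w)=0$ (antiholomorphic case), where at infinity the equation is read through the bihomogenization of $P$. The (anti)holomorphic correspondence $F$ is $F(z)=\{w:(z,w)\in\Gamma\}$, with $F^0(z)=\{z\}$ and $F^{n+1}(z)=\bigcup_{y\in F^{n}(z)}F(y)$. For $x\in\widehat{\mathbb C}$ let $\Lambda_+(x)=\bigcap_{n\ge0}\overline{\bigcup_{k\ge n}F^k(x)}$. The set $\mathrm{Sing}_F$ consists of the first coordinates of those points $a\in\Gamma$ such that the first projection is injective on $\Gamma\cap W$ for no neighbourhood $W$ of $a$. $F$ is *invariantly inverse-like* on $S$ if $F(S)\subseteq S$ and every $w\in F(S)$ has exactly one $z\in S$ with $w\in F(z)$. A *branch* of $F^n$ on an open set $U$ is a holomorphic or antiholomorphic map $f\colon U\to\widehat{\mathbb C}$ with $f(z)\in F^n(z)$ for all $z\in U$; *all branches of $F^n$ are defined on $U$* if there are finitely many branches on $U$ and $F^n(z)$ is the set of their values at $z$, for every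 $z\in U$. A *branch domain* of $x$ is a connected open neighbourhood $U$ of $x$ on which all branches of $F^n$ are defined for all $n\ge1$; then $f_{n,1},\dots,f_{n,M_n}$ denote the distinct branches of $F^n$ on $U$. With $|Df|$ the derivative in the spherical metric, put $$P_s(x)=\sum_{n\ge0}\sum_{j=1}^{M_n}|Df_{n,j}(x)|^s\in[0,\infty]$$ (independent of $U$; $P_s(x)=\infty$ if there is no branch domain), and $\delta_{\rm crit}(x)=\inf\{s>0:P_s(x)<\infty\}\in[0,\infty]$, with $\inf\emptyset=\infty$. A *special pair* of $\Lambda\subseteq\widehat{\mathbb C}$ is a pair $(A,f)$ of a connected Borel set $A$ and a branch $f$ of $F$ on a neighbourhood of $A$ such that $f$ is injective on $A$ and $f(A\smallsetminus\Lambda)\cap\Lambda=\emptyset$. A Borel probability measure $\mu$ with support contained in $\Lambda$ is *$\delta$-conformal* for $F$ and $\Lambda$ if $\mu(f(A))=\int_A|Df|^\delta\,d\mu$ for every special pair $(A,f)$ of $\Lambda$. **Proposition.** Let $F$ be an (anti)holomorphic correspondence that is invariantly inverse-like on a closed set $S$, and let $x\in S$ satisfy $0<\delta:=\delta_{\rm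 crit}(x)<\infty$ and $\Lambda_+(x)\cap\mathrm{Sing}_F=\emptyset$. Then there exists a $\delta$-conformal measure for $F$ and $\Lambda_+(x)$. More precisely, the following holds for the branches on any branch domain $U$ of $x$. 1. If $P_s(x)\to\infty$ as $s\searrow\delta$, then $$\mu_s=\frac1{P_s(x)}\sum_{n\ge0}\sum_{j=1}^{M_n}|Df_{n,j}(x)|^s\,\delta_{f_{n,j}(x)}$$ is a probability measure for all $s>\delta$ close to $\delta$, and every weak* limit (accumulation point) of $\mu_s$ as $s\searrow\delta$ is a $\delta$-conformal measure for $F$ and $\Lambda_+(x)$. 2. Otherwise, for every function $h_0\colon\mathbb R\to\mathbb R$ there is a function $h\ge h_0$, not depending on $U$, such that, with $t_s(n)=2\delta-s$ if $n<h(1/(s-\delta))$ and $t_s(n)=s$ otherwise, the modified series $$\widetilde P_s(x)=\sum_{n\ge0}\sum_{j=1}^{M_n}|Df_{n,j}(x)|^{t_s(n)}$$ tends to $\infty$ as $s\searrow\delta$, the measures $$\mu_s=\frac1{\widetilde P_s(x)}\sum_{n\ge0}\sum_{j=1}^{M_n}|Df_{n,j}(x)|^{t_s(n)}\,\delta_{f_{n,j}(x)}$$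 are probability measures for all $s>\delta$ close to $\delta$, and every weak* limit of $\mu_s$ as $s\searrow\delta$ is a $\delta$-conformal measure for $F$ and $\Lambda_+(x)$. -/

import Mathlib

open Set Filter Topology MeasureTheory
open scoped ENNReal

noncomputable section

namespace AlgCorr

/-! ### The Riemann sphere -/

/-- The Riemann sphere, as the one-point compactification of the complex plane. -/
abbrev Sphere : Type := OnePoint ℂ

/-- The sphere carries its Borel sigma-algebra. -/
instance : MeasurableSpace Sphere := borel Sphere

instance : BorelSpace Sphere := ⟨rfl⟩

/-- The finite coordinate of a point (with the value `0` at infinity). -/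
def coord (p : Sphere) : ℂ := p.elim 0 id

/-- The inversion `z ↦ 1 / z`, exchanging `0` and infinity. -/
def inversion (p : Sphere) : Sphere :=
  open Classical in p.elim ((0 : ℂ) : Sphere) fun z => if z = 0 then OnePoint.infty else ((z⁻¹ : ℂ) : Sphere)

/-- The coordinate used near `p`: `z` near a finite point, `1 / z` near infinity. -/
def chart (p q : Sphere) : ℂ :=
  open Classical in if p = OnePoint.infty then coord (inversion q) else coord q

/-- The parametrization inverse to `chart p`. -/
def chartInv (p : Sphere) (t : ℂ) : Sphere :=
  open Classical in if p = OnePoint.infty then inversion (t : Sphere) else (t : Sphere)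

/-- The expression of `f` in the coordinates near `p` and near `f p`. -/
def localRep (f : Sphere → Sphere) (p : Sphere) (t : ℂ) : ℂ :=
  chart (f p) (f (chartInv p t))

/-- `f` is holomorphic in a neighbourhood of `p`. -/
def HolomorphicNear (f : Sphere → Sphere) (p : Sphere) : Prop :=
  ContinuousAt f p ∧ AnalyticAt ℂ (localRep f p) (chart p p)

/-- `f` is antiholomorphic in a neighbourhood of `p`. -/
def AntiholomorphicNear (f : Sphere → Sphere) (p : Sphere) : Prop :=
  ContinuousAt f p ∧ AnalyticAt ℂ (fun t => (starRingEnd ℂ) (localRep f p t)) (chart p p)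

/-- `|Df|(p)`: the norm of the total derivative of `f` at `p` in the spherical metric
`2 |dz| / (1 + |z|²)`. The inversion is an isometry of this metric, so that the same formula
holds in the coordinate `1 / z`. -/
def sphDeriv (f : Sphere → Sphere) (p : Sphere) : ℝ :=
  ‖fderiv ℝ (localRep f p) (chart p p)‖ * (1 + ‖chart p p‖ ^ 2) / (1 + ‖chart (f p) (f p)‖ ^ 2)

/-! ### Correspondences -/

/-- The data of an (anti)holomorphic correspondence: a polynomial `P` in two variables (variable
`0` is `z` and variable `1` is `w`); the flag `anti` tells whether the equation is
`P(z, w) = 0` (`false`) or `P(conj z, w) = 0` (`true`). -/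
structure Correspondence where
  poly : MvPolynomial (Fin 2) ℂ
  anti : Bool

/-- Homogeneous coordinates of a point of the sphere: `[z : 1]` or `[1 : 0]`. -/
def homCoord (p : Sphere) : ℂ × ℂ := p.elim (1, 0) fun z => (z, 1)

/-- The bihomogenization of `P` (of bidegree the degrees of `P` in its two variables),
evaluated at homogeneous coordinates of `p` and `q`. -/
def bihomEval (P : MvPolynomial (Fin 2) ℂ) (p q : Sphere) : ℂ :=
  ∑ m ∈ P.support, P.coeff m
    * ((homCoord p).1 ^ m 0 * (homCoord p).2 ^ (P.degreeOf 0 - m 0))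
    * ((homCoord q).1 ^ m 1 * (homCoord q).2 ^ (P.degreeOf 1 - m 1))

/-- Complex conjugation on the sphere, fixing infinity. -/
def sphConj : Sphere → Sphere := OnePoint.map (starRingEnd ℂ)

namespace Correspondence

variable (F : Correspondence)

/-- The curve `Γ` in the product of two spheres defined by `P(z, w) = 0`
(or `P(conj z, w) = 0`). -/
def graph : Set (Sphere × Sphere) :=
  {a | bihomEval F.poly (if F.anti then sphConj a.1 else a.1) a.2 = 0}

/-- `F(z)`. -/
def image (z : Sphere) : Set Sphere := {w | (z, w) ∈ F.graph}

/-- `F^n(z)`, where `F^0` is the identity. -/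
def iter : ℕ → Sphere → Set Sphere
  | 0, z => {z}
  | n + 1, z => ⋃ y ∈ iter n z, F.image y

/-- The forward limit set `Λ₊(x)`. -/
def limitSet (x : Sphere) : Set Sphere :=
  ⋂ n : ℕ, closure (⋃ k ≥ n, F.iter k x)

/-- The singular points of `F`: the first coordinates of the points of `Γ` near which the first
projection is not injective on `Γ`. -/
def sing : Set Sphere :=
  Prod.fst '' {a | a ∈ F.graph ∧ ∀ W ∈ 𝓝 a, ¬ InjOn Prod.fst (F.graph ∩ W)}

/-- `F` is invariantly inverse-like on `S`: `F(S) ⊆ S`, and each `w ∈ F(S)` has exactly one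
preimage in `S`. -/
def InvariantlyInverseLike (S : Set Sphere) : Prop :=
  (⋃ z ∈ S, F.image z) ⊆ S ∧ ∀ w ∈ ⋃ z ∈ S, F.image z, ∃! z, z ∈ S ∧ w ∈ F.image z

end Correspondence

/-! ### Branches -/

/-- `f` is, on the open set `U`, a single-valued holomorphic or antiholomorphic selection of the
multivalued map `G`. -/
def IsBranchOn (G : Sphere → Set Sphere) (U : Set Sphere) (f : Sphere → Sphere) : Prop :=
  ((∀ p ∈ U, HolomorphicNear f p) ∨ (∀ p ∈ U, AntiholomorphicNear f p)) ∧ ∀ p ∈ U, f p ∈ G p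

/-- The set of branches of `G` on `U`. A branch is a function on `U`; it is given the value
infinity outside `U`, so that two branches are equal as soon as they agree on `U`. -/
def branches (G : Sphere → Set Sphere) (U : Set Sphere) : Set (Sphere → Sphere) :=
  {f | IsBranchOn G U f ∧ ∀ p ∉ U, f p = OnePoint.infty}

/-- All branches of `G` are defined on `U`: finitely many branches on `U` exhaust `G`. -/
def AllBranchesDefined (G : Sphere → Set Sphere) (U : Set Sphere) : Prop :=
  (branches G U).Finite ∧ ∀ z ∈ U, G z = {w | ∃ f ∈ branches G U, f z = w}

namespace Correspondence

variable (F : Correspondence)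

/-- `U` is a (connected, open) neighbourhood of `x` on which all branches of all iterates of `F`
are defined. -/
def IsBranchDomain (x : Sphere) (U : Set Sphere) : Prop :=
  IsOpen U ∧ IsConnected U ∧ x ∈ U ∧ ∀ n : ℕ, 1 ≤ n → AllBranchesDefined (F.iter n) U

/-! ### Poincaré series and the critical exponent -/

/-- The sum over `n ≥ 0` and over the branches `f` of `F^n` on `U` of `|Df(x)| ^ t(n)`. -/
def weightedSeries (x : Sphere) (U : Set Sphere) (t : ℕ → ℝ) : ℝ≥0∞ :=
  ∑' n : ℕ, ∑' f : branches (F.iter n) U, ENNReal.ofReal (sphDeriv f.1 x) ^ t n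

/-- The Poincaré series `P_s(x)`. It does not depend on the branch domain `U` of `x`, and is
`∞` if there is no such `U`: the infimum expresses both. -/
def poincareSeries (x : Sphere) (s : ℝ) : ℝ≥0∞ :=
  ⨅ (U : Set Sphere) (_ : F.IsBranchDomain x U), F.weightedSeries x U fun _ => s

/-- The critical exponent of `F` at `x`; the infimum of the empty set is `∞`. -/
def critExponent (x : Sphere) : ℝ≥0∞ :=
  sInf (ENNReal.ofReal '' {s : ℝ | 0 < s ∧ F.poincareSeries x s < ∞})

/-! ### Patterson–Sullivan measures -/

/-- The normalized sum, over `n ≥ 0` and over the branches `f` of `F^n` on `U`, of the Dirac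
masses at `f(x)` with weights `|Df(x)| ^ t(n)`. -/
def psMeasure (x : Sphere) (U : Set Sphere) (t : ℕ → ℝ) : Measure Sphere :=
  (F.weightedSeries x U t)⁻¹ •
    Measure.sum fun n : ℕ => Measure.sum fun f : branches (F.iter n) U =>
      ENNReal.ofReal (sphDeriv f.1 x) ^ t n • Measure.dirac (f.1 x)

end Correspondence

/-- The modified exponents: `2δ - s` for `n < h(1 / (s - δ))`, and `s` otherwise. -/
def modifiedExponent (h : ℝ → ℝ) (δ s : ℝ) (n : ℕ) : ℝ :=
  open Classical in if (n : ℝ) < h (1 / (s - δ)) then 2 * δ - s else s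

/-- `μ` is a weak* limit, i.e. a weak* accumulation point, of the measures `m s` as `s` decreases
to `δ`: the limit along some (proper) filter finer than that of right neighbourhoods of `δ`. -/
def IsWeakStarLimit (m : ℝ → Measure Sphere) (δ : ℝ) (μ : Measure Sphere) : Prop :=
  ∃ l : Filter ℝ, l.NeBot ∧ l ≤ 𝓝[>] δ ∧
    ∀ φ : C(Sphere, ℝ), Tendsto (fun s => ∫ z, φ z ∂(m s)) l (𝓝 (∫ z, φ z ∂μ))

namespace Correspondence

variable (F : Correspondence)

/-! ### Conformal measures -/

/-- `(A, f)` is a special pair of `Λ`: `A` is a connected Borel set, `f` is a branch of `F`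
defined (on a neighbourhood of `A`) and injective on `A`, and `f(A ∖ Λ)` is disjoint from `Λ`. -/
def IsSpecialPair (Λ A : Set Sphere) (f : Sphere → Sphere) : Prop :=
  MeasurableSet A ∧ IsConnected A ∧ (∃ V, IsOpen V ∧ A ⊆ V ∧ IsBranchOn F.image V f) ∧
    InjOn f A ∧ f '' (A \ Λ) ∩ Λ = ∅

/-- `μ` is a `δ`-conformal measure for `F` and `Λ`. -/
def IsConformal (Λ : Set Sphere) (δ : ℝ) (μ : Measure Sphere) : Prop :=
  IsProbabilityMeasure μ ∧ μ.support ⊆ Λ ∧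
    ∀ (A : Set Sphere) (f : Sphere → Sphere), F.IsSpecialPair Λ A f →
      μ (f '' A) = ∫⁻ z in A, ENNReal.ofReal (sphDeriv f z) ^ δ ∂μ

end Correspondence

end AlgCorr

end

noncomputable section

namespace AlgCorr

/-! ### Topology of the sphere and its charts -/

/-! The proof is the Patterson–Sullivan construction. On a branch domain the branches of `F^n`
correspond to germs at `x` (`branchesEquivGerms`, by the identity theorem), so every sum is a sum
over germs and no longer sees `U`.

Conformality comes from a shift of levels. Let `a` be a point of the limit set and `f` a branch of
`F` near `a`. Since `a` is nonsingular and is the only point of `S` over `f a`, all of `F`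
restricted to `S` with values near `f a` is given by `f` near `a` (`exists_nhds_branch`). Hence the
germs of `F^(n+1)` with value near `f a` are exactly the composites of `f` with germs of `F^n`, up
to terms of weight zero, and the chain rule multiplies the weights by a power of `|Df|`
(`tsum_germBranches_succ`). Summation over `n` gives `∫ φ dμ = ∫ |Df|^δ (φ ∘ f) dμ` in the limit,
for `φ` supported near `f a` (`IsAdmissible.lintegral_eq`). The errors are the level `0` term, the
replacement of the exponent by `δ`, and the change of exponent between consecutive levels.
`IsAdmissible` collects what makes them vanish after normalization. A countable cover and the
injectivity of `f` on the limit set then yield the formula for sets (`IsAdmissible.isConformal`).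

If the Poincaré series diverges at `δ`, constant exponents have no jump. Otherwise the exponent `2δ
- s < δ` is used up to a level `m`, where the partial sums are already huge. Hölder's inequality and
the exponential bound on the number of branches show that the level sums at `2δ - s` grow at a rate
tending to `1` as `s` decreases to `δ`. So `m` can be chosen such that level `m` is a small fraction
of the partial sum, which makes the single jump negligible (`exists_le_mul_sum`,
`exists_isAdmissible_modifiedExponent`). -/

instance : SecondCountableTopology Sphere := by
  have h : Module.finrank ℝ ℂ + 1 = Fintype.card (Fin 3) := by
    simp [Complex.finrank_real_complex]
  exact (onePointEquivSphereOfFinrankEq (ι := Fin 3) h).secondCountableTopology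

instance : PolishSpace Sphere := by
  let := TopologicalSpace.metrizableSpaceMetric Sphere
  infer_instance

@[simp] lemma coord_coe (z : ℂ) : coord (z : Sphere) = z := rfl

@[simp] lemma inversion_infty : inversion OnePoint.infty = ((0 : ℂ) : Sphere) := rfl

@[simp] lemma inversion_zero : inversion ((0 : ℂ) : Sphere) = OnePoint.infty := by
  simp [inversion]

lemma inversion_coe {z : ℂ} (hz : z ≠ 0) : inversion (z : Sphere) = ((z⁻¹ : ℂ) : Sphere) := by
  simp [inversion, hz]

@[simp] lemma inversion_inversion (p : Sphere) : inversion (inversion p) = p := by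
  induction p using OnePoint.rec with
  | infty => simp
  | coe z =>
    by_cases hz : z = 0
    · simp [hz]
    · rw [inversion_coe hz, inversion_coe (inv_ne_zero hz), inv_inv]

lemma continuous_inversion : Continuous inversion := by
  rw [continuous_iff_continuousAt]
  intro p
  induction p using OnePoint.rec with
  | infty =>
    rw [OnePoint.continuousAt_infty']
    rw [coclosedCompact_eq_cocompact]
    have h1 : Tendsto (fun z : ℂ => ((z⁻¹ : ℂ) : Sphere)) (cocompact ℂ) (𝓝 ((0 : ℂ) : Sphere)) :=
      (OnePoint.continuous_coe.tendsto 0).comp (by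
        rw [← Metric.cobounded_eq_cocompact]; exact tendsto_inv₀_cobounded)
    refine h1.congr' ?_
    have : ∀ᶠ z : ℂ in cocompact ℂ, z ≠ 0 := by
      have := (isCompact_singleton (x := (0 : ℂ))).compl_mem_cocompact
      filter_upwards [this] with z hz using hz
    filter_upwards [this] with z hz
    simp [inversion_coe hz]
  | coe z =>
    rw [OnePoint.continuousAt_coe]
    by_cases hz : z = 0
    · subst hz
      rw [continuousAt_iff_punctured_nhds]
      have h1 : Tendsto (fun z : ℂ => ((z⁻¹ : ℂ) : Sphere)) (𝓝[≠] 0) (𝓝 OnePoint.infty) := by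
        refine OnePoint.tendsto_coe_infty.comp ?_
        rw [coclosedCompact_eq_cocompact, ← Metric.cobounded_eq_cocompact]
        exact tendsto_inv₀_nhdsNE_zero
      simp only [Function.comp_apply, inversion_zero]
      refine h1.congr' ?_
      filter_upwards [self_mem_nhdsWithin] with z hz
      simp [inversion_coe hz]
    · have h1 : ContinuousAt (fun z : ℂ => ((z⁻¹ : ℂ) : Sphere)) z :=
        OnePoint.continuous_coe.continuousAt.comp (continuousAt_inv₀ hz)
      refine h1.congr ?_
      filter_upwards [isOpen_ne.mem_nhds hz] with w hw
      simp [inversion_coe hw]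

lemma continuousAt_coord {p : Sphere} (hp : p ≠ OnePoint.infty) : ContinuousAt coord p := by
  lift p to ℂ using hp
  rw [OnePoint.continuousAt_coe]
  exact continuousAt_id

lemma coe_coord {p : Sphere} (hp : p ≠ OnePoint.infty) : ((coord p : ℂ) : Sphere) = p := by
  lift p to ℂ using hp
  rfl

@[simp] lemma chart_infty (q : Sphere) : chart OnePoint.infty q = coord (inversion q) := by
  simp [chart]

lemma chart_of_ne {p : Sphere} (hp : p ≠ OnePoint.infty) (q : Sphere) : chart p q = coord q := by
  simp [chart, hp]

@[simp] lemma chart_coe (z : ℂ) (q : Sphere) : chart (z : Sphere) q = coord q := by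
  simp [chart]

@[simp] lemma chartInv_infty (t : ℂ) : chartInv OnePoint.infty t = inversion (t : Sphere) := by
  simp [chartInv]

@[simp] lemma chartInv_coe (z t : ℂ) : chartInv (z : Sphere) t = (t : Sphere) := by
  simp [chartInv]

@[simp] lemma chart_chartInv (p : Sphere) (t : ℂ) : chart p (chartInv p t) = t := by
  induction p using OnePoint.rec <;> simp

lemma continuous_chartInv (p : Sphere) : Continuous (chartInv p) := by
  induction p using OnePoint.rec with
  | infty =>
    simp only [funext chartInv_infty]
    exact continuous_inversion.comp OnePoint.continuous_coe
  | coe z =>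
    simp only [funext (chartInv_coe z)]
    exact OnePoint.continuous_coe

/-- The domain of `chart p`. -/
def chartSource (p : Sphere) : Set Sphere := {q | chartInv p (chart p q) = q}

lemma chartSource_infty : chartSource OnePoint.infty = {((0 : ℂ) : Sphere)}ᶜ := by
  ext q
  simp only [chartSource, mem_ofPred_eq, chart_infty, chartInv_infty, mem_compl_iff,
    mem_singleton_iff]
  constructor
  · rintro h rfl
    have : coord (OnePoint.infty : Sphere) = 0 := rfl
    simp [this] at h
  · intro h
    have : inversion q ≠ OnePoint.infty := fun h' => h (by rw [← inversion_inversion q, h']; simp)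
    rw [coe_coord this, inversion_inversion]

lemma chartSource_coe (z : ℂ) : chartSource (z : Sphere) = {OnePoint.infty}ᶜ := by
  ext q
  simp only [chartSource, mem_ofPred_eq, chart_coe, chartInv_coe, mem_compl_iff,
    mem_singleton_iff]
  constructor
  · rintro h rfl
    simp at h
  · exact coe_coord

lemma isOpen_chartSource (p : Sphere) : IsOpen (chartSource p) := by
  induction p using OnePoint.rec with
  | infty => rw [chartSource_infty]; exact isOpen_compl_singleton
  | coe z => rw [chartSource_coe]; exact isOpen_compl_singleton

lemma mem_chartSource (p : Sphere) : p ∈ chartSource p := by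
  induction p using OnePoint.rec with
  | infty => simp [chartSource_infty]
  | coe z => simp [chartSource_coe]

lemma chartSource_mem_nhds (p : Sphere) : chartSource p ∈ 𝓝 p :=
  (isOpen_chartSource p).mem_nhds (mem_chartSource p)

@[simp] lemma chartInv_chart_self (p : Sphere) : chartInv p (chart p p) = p := mem_chartSource p

lemma continuousAt_chart {p q : Sphere} (hq : q ∈ chartSource p) : ContinuousAt (chart p) q := by
  induction p using OnePoint.rec with
  | infty =>
    simp only [funext chart_infty]
    rw [chartSource_infty] at hq
    refine ContinuousAt.comp (continuousAt_coord fun h' => hq ?_) continuous_inversion.continuousAt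
    rw [mem_singleton_iff, ← inversion_inversion q, h', inversion_infty]
  | coe z =>
    simp only [funext (chart_coe z)]
    rw [chartSource_coe] at hq
    exact continuousAt_coord hq

lemma injOn_chart (p : Sphere) : InjOn (chart p) (chartSource p) := fun a ha b hb h => by
  rw [← ha, ← hb, h]

lemma tendsto_chartInv (p : Sphere) : Tendsto (chartInv p) (𝓝 (chart p p)) (𝓝 p) := by
  have := (continuous_chartInv p).tendsto (chart p p)
  rwa [chartInv_chart_self] at this

lemma localRep_chart {f : Sphere → Sphere} {p q : Sphere} (hq : q ∈ chartSource p) :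
    localRep f p (chart p q) = chart (f p) (f q) := by
  rw [localRep, hq]

lemma localRep_congr {f g : Sphere → Sphere} {p : Sphere} (h : f =ᶠ[𝓝 p] g) :
    localRep f p =ᶠ[𝓝 (chart p p)] localRep g p := by
  filter_upwards [(tendsto_chartInv p).eventually h] with t ht
  rw [localRep, localRep, ht, h.eq_of_nhds]

lemma sphDeriv_congr {f g : Sphere → Sphere} {p : Sphere} (h : f =ᶠ[𝓝 p] g) :
    sphDeriv f p = sphDeriv g p := by
  rw [sphDeriv, sphDeriv, (localRep_congr h).fderiv_eq, h.eq_of_nhds]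

/-- The intermediate chart cancels only where `g` takes values in its domain, so the identity is one
of germs. -/
lemma localRep_comp {f g : Sphere → Sphere} {p : Sphere} (hg : ContinuousAt g p) :
    localRep (f ∘ g) p =ᶠ[𝓝 (chart p p)] localRep f (g p) ∘ localRep g p := by
  have h1 : Tendsto (fun t => g (chartInv p t)) (𝓝 (chart p p)) (𝓝 (g p)) :=
    hg.tendsto.comp (tendsto_chartInv p)
  filter_upwards [h1 (chartSource_mem_nhds (g p))] with t ht
  simp only [localRep, Function.comp_apply]
  rw [show chartInv (g p) (chart (g p) (g (chartInv p t))) = g (chartInv p t) from ht]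

@[simp] lemma localRep_self (f : Sphere → Sphere) (p : Sphere) :
    localRep f p (chart p p) = chart (f p) (f p) := by
  simp [localRep]

lemma sphDeriv_nonneg (f : Sphere → Sphere) (p : Sphere) : 0 ≤ sphDeriv f p := by
  unfold sphDeriv; positivity

/-! ### Holomorphic and antiholomorphic germs -/

/-- `f` is holomorphic or antiholomorphic near `p`. -/
def ConformalNear (f : Sphere → Sphere) (p : Sphere) : Prop :=
  HolomorphicNear f p ∨ AntiholomorphicNear f p

lemma HolomorphicNear.congr {f g : Sphere → Sphere} {p : Sphere} (hf : HolomorphicNear f p)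
    (h : f =ᶠ[𝓝 p] g) : HolomorphicNear g p :=
  ⟨hf.1.congr h, hf.2.congr (localRep_congr h)⟩

lemma ConformalNear.continuousAt {f : Sphere → Sphere} {p : Sphere} (hf : ConformalNear f p) :
    ContinuousAt f p := hf.elim (·.1) (·.1)

/-- Needed when the inner map of a composite is antiholomorphic: a conjugation is inserted between
the two maps and absorbed into the outer one. -/
lemma analyticAt_conj_conj {f : ℂ → ℂ} {z : ℂ} (hf : AnalyticAt ℂ f z) :
    AnalyticAt ℂ (fun t => (starRingEnd ℂ) (f ((starRingEnd ℂ) t))) ((starRingEnd ℂ) z) := by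
  rw [Complex.analyticAt_iff_eventually_differentiableAt] at hf ⊢
  have hc : Tendsto (starRingEnd ℂ) (𝓝 ((starRingEnd ℂ) z)) (𝓝 z) := by
    have := Complex.continuous_conj.tendsto ((starRingEnd ℂ) z)
    rwa [Complex.conj_conj] at this
  filter_upwards [hc.eventually hf] with t ht
  have := ht.hasDerivAt.conj_conj
  rw [Complex.conj_conj] at this
  exact this.differentiableAt

lemma HolomorphicNear.comp {f g : Sphere → Sphere} {p : Sphere} (hf : HolomorphicNear f (g p))
    (hg : HolomorphicNear g p) : HolomorphicNear (f ∘ g) p := by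
  refine ⟨hf.1.comp hg.1, AnalyticAt.congr ?_ (localRep_comp hg.1).symm⟩
  have := hf.2
  rw [← localRep_self g p] at this
  exact this.comp hg.2

lemma AntiholomorphicNear.comp_holomorphic {f g : Sphere → Sphere} {p : Sphere}
    (hf : AntiholomorphicNear f (g p)) (hg : HolomorphicNear g p) :
    AntiholomorphicNear (f ∘ g) p := by
  refine ⟨hf.1.comp hg.1, AnalyticAt.congr ?_
    ((localRep_comp hg.1).symm.fun_comp (starRingEnd ℂ))⟩
  have := hf.2
  rw [← localRep_self g p] at this
  exact this.comp hg.2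

lemma HolomorphicNear.comp_antiholomorphic {f g : Sphere → Sphere} {p : Sphere}
    (hf : HolomorphicNear f (g p)) (hg : AntiholomorphicNear g p) :
    AntiholomorphicNear (f ∘ g) p := by
  refine ⟨hf.1.comp hg.1, AnalyticAt.congr ?_
    ((localRep_comp hg.1).symm.fun_comp (starRingEnd ℂ))⟩
  have := analyticAt_conj_conj hf.2
  rw [← localRep_self g p] at this
  have h2 := AnalyticAt.fun_comp (f := fun t => (starRingEnd ℂ) (localRep g p t)) this hg.2
  simpa [Function.comp_def] using h2

lemma AntiholomorphicNear.comp {f g : Sphere → Sphere} {p : Sphere}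
    (hf : AntiholomorphicNear f (g p)) (hg : AntiholomorphicNear g p) :
    HolomorphicNear (f ∘ g) p := by
  refine ⟨hf.1.comp hg.1, AnalyticAt.congr ?_ (localRep_comp hg.1).symm⟩
  have := analyticAt_conj_conj hf.2
  rw [← localRep_self g p] at this
  have h2 := AnalyticAt.fun_comp (f := fun t => (starRingEnd ℂ) (localRep g p t)) this hg.2
  simpa [Function.comp_def] using h2

lemma ConformalNear.comp {f g : Sphere → Sphere} {p : Sphere} (hf : ConformalNear f (g p))
    (hg : ConformalNear g p) : ConformalNear (f ∘ g) p := by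
  rcases hf with hf | hf <;> rcases hg with hg | hg
  · exact .inl (hf.comp hg)
  · exact .inr (hf.comp_antiholomorphic hg)
  · exact .inr (hf.comp_holomorphic hg)
  · exact .inl (hf.comp hg)

lemma ConformalNear.analyticAt {f : Sphere → Sphere} {p : Sphere} (hf : ConformalNear f p) :
    AnalyticAt ℝ (localRep f p) (chart p p) := by
  rcases hf with hf | hf
  · exact hf.2.restrictScalars
  · have h1 : AnalyticAt ℝ (fun t => (starRingEnd ℂ) (localRep f p t)) (chart p p) :=
      hf.2.restrictScalars
    have h2 := (Complex.conjCLE : ℂ →L[ℝ] ℂ).analyticAt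
      ((starRingEnd ℂ) (localRep f p (chart p p)))
    have h3 := AnalyticAt.fun_comp (f := fun t => (starRingEnd ℂ) (localRep f p t)) h2 h1
    simpa using h3

/-- The derivative of an (anti)holomorphic germ is a similarity. -/
lemma ConformalNear.norm_fderiv_apply {f : Sphere → Sphere} {p : Sphere} (hf : ConformalNear f p)
    (v : ℂ) : ‖fderiv ℝ (localRep f p) (chart p p) v‖ =
      ‖fderiv ℝ (localRep f p) (chart p p)‖ * ‖v‖ := by
  have key : ∃ c : ℝ, ∀ v, ‖fderiv ℝ (localRep f p) (chart p p) v‖ = c * ‖v‖ := by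
    rcases hf with hf | hf
    · have h1 := hf.2.differentiableAt.hasDerivAt.hasFDerivAt.restrictScalars ℝ
      refine ⟨‖deriv (localRep f p) (chart p p)‖, fun v => ?_⟩
      rw [h1.fderiv]
      simp [mul_comm]
    · have h1 := hf.2.differentiableAt.hasDerivAt.hasFDerivAt.restrictScalars ℝ
      have h2 := (Complex.conjCLE : ℂ →L[ℝ] ℂ).hasFDerivAt.comp _ h1
      have h3 : (Complex.conjCLE : ℂ →L[ℝ] ℂ) ∘
          (fun t => (starRingEnd ℂ) (localRep f p t)) = localRep f p := by
        ext t; simp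
      rw [h3] at h2
      refine ⟨‖deriv (fun t => (starRingEnd ℂ) (localRep f p t)) (chart p p)‖, fun v => ?_⟩
      rw [h2.fderiv]
      simp [mul_comm]
  obtain ⟨c, hc⟩ := key
  have : ‖fderiv ℝ (localRep f p) (chart p p)‖ = c :=
    ContinuousLinearMap.homothety_norm _ hc
  rw [this, hc]

/-- The chain rule for the spherical derivative. -/
lemma sphDeriv_comp {f g : Sphere → Sphere} {p : Sphere} (hf : ConformalNear f (g p))
    (hg : ConformalNear g p) : sphDeriv (f ∘ g) p = sphDeriv f (g p) * sphDeriv g p := by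
  have h1 : fderiv ℝ (localRep (f ∘ g) p) (chart p p) =
      (fderiv ℝ (localRep f (g p)) (chart (g p) (g p))).comp
        (fderiv ℝ (localRep g p) (chart p p)) := by
    have h := hf.analyticAt
    rw [← localRep_self g p] at h
    rw [(localRep_comp hg.continuousAt).fderiv_eq,
      fderiv_comp _ h.differentiableAt hg.analyticAt.differentiableAt, localRep_self]
  have h2 : ‖fderiv ℝ (localRep (f ∘ g) p) (chart p p)‖ =
      ‖fderiv ℝ (localRep f (g p)) (chart (g p) (g p))‖ *
        ‖fderiv ℝ (localRep g p) (chart p p)‖ := by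
    rw [h1]
    -- Operator norms are multiplicative here because both derivatives are homotheties; in general
    -- only an inequality holds.
    refine ContinuousLinearMap.homothety_norm _ fun v => ?_
    rw [ContinuousLinearMap.comp_apply, hf.norm_fderiv_apply, hg.norm_fderiv_apply, mul_assoc]
  simp only [sphDeriv, Function.comp_apply, h2]
  have : (1 + ‖chart (g p) (g p)‖ ^ 2) ≠ 0 := by positivity
  field_simp

/-! ### The identity theorem -/

lemma eq_of_mem_interior {X Y : Type*} [TopologicalSpace X] {f g : X → Y} {q : X}
    (h : q ∈ interior {q | f q = g q}) : f q = g q := by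
  have : q ∈ {q | f q = g q} := interior_subset h
  exact this

/-- Real analyticity suffices for the identity theorem and allows a holomorphic germ to be compared
with an antiholomorphic one. Agreement is only required on open sets accumulating at `p`, which is
what finite closed covers provide. -/
lemma ConformalNear.eventuallyEq {f g : Sphere → Sphere} {p : Sphere} (hf : ConformalNear f p)
    (hg : ConformalNear g p) (h : p ∈ closure (interior {q | f q = g q})) : f =ᶠ[𝓝 p] g := by
  have hfg : f p = g p := by
    have : (𝓝[interior {q | f q = g q}] p).NeBot := mem_closure_iff_nhdsWithin_neBot.1 h
    refine tendsto_nhds_unique_of_eventuallyEq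
      (hf.continuousAt.tendsto.mono_left nhdsWithin_le_nhds)
      (hg.continuousAt.tendsto.mono_left nhdsWithin_le_nhds)
      (l := 𝓝[interior {q | f q = g q}] p) ?_
    filter_upwards [self_mem_nhdsWithin] with q hq using eq_of_mem_interior hq
  obtain ⟨r, hr, hball⟩ := Metric.eventually_nhds_iff_ball.1
    (hf.analyticAt.eventually_analyticAt.and hg.analyticAt.eventually_analyticAt)
  have hch := (continuousAt_chart (mem_chartSource p)).preimage_mem_nhds
    (Metric.ball_mem_nhds (chart p p) hr)
  obtain ⟨q, ⟨hq1, hq2⟩, hq3⟩ := mem_closure_iff_nhds.1 h _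
    (inter_mem hch (chartSource_mem_nhds p))
  have hev : localRep f p =ᶠ[𝓝 (chart p q)] localRep g p := by
    have h1 := (continuous_chartInv p).tendsto (chart p q)
    rw [show chartInv p (chart p q) = q from hq2] at h1
    filter_upwards [h1 (isOpen_interior.mem_nhds hq3)] with t ht
    have : f (chartInv p t) = g (chartInv p t) := eq_of_mem_interior ht
    rw [localRep, localRep, this, hfg]
  have heq : EqOn (localRep f p) (localRep g p) (Metric.ball (chart p p) r) :=
    AnalyticOnNhd.eqOn_of_preconnected_of_eventuallyEq (𝕜 := ℝ) (fun t ht => (hball t ht).1)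
      (fun t ht => (hball t ht).2) (convex_ball _ _).isPreconnected hq1 hev
  filter_upwards [hch, chartSource_mem_nhds p,
    hf.continuousAt (chartSource_mem_nhds (f p)),
    hg.continuousAt (hfg ▸ chartSource_mem_nhds (f p))] with z hz1 hz2 hz3 hz4
  have := heq hz1
  rw [localRep_chart hz2, localRep_chart hz2, ← hfg] at this
  exact injOn_chart _ hz3 (hfg ▸ hz4) this

lemma eqOn_of_conformalNear {f g : Sphere → Sphere} {U : Set Sphere} {p : Sphere}
    (hU : IsPreconnected U) (hf : ∀ q ∈ U, ConformalNear f q) (hg : ∀ q ∈ U, ConformalNear g q)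
    (hp : p ∈ U) (h : f =ᶠ[𝓝 p] g) : EqOn f g U := by
  have hsub : U ⊆ interior {q | f q = g q} := by
    refine hU.subset_of_closure_inter_subset isOpen_interior
      ⟨p, hp, mem_interior_iff_mem_nhds.2 h⟩ fun q hq => ?_
    exact mem_interior_iff_mem_nhds.2 ((hf q hq.2).eventuallyEq (hg q hq.2) hq.1)
  exact fun q hq => eq_of_mem_interior (hsub hq)

/-- If an open set is covered by finitely many closed sets, one of them has interior points in
the open set. -/
lemma exists_nonempty_interior_of_finite_cover {X ι : Type*} [TopologicalSpace X] {J : Set ι}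
    (hJ : J.Finite) {C : ι → Set X} (hC : ∀ j ∈ J, IsClosed (C j)) {O : Set X} (hO : IsOpen O)
    (hne : O.Nonempty) (hcov : O ⊆ ⋃ j ∈ J, C j) : ∃ j ∈ J, (O ∩ interior (C j)).Nonempty := by
  induction J, hJ using Set.Finite.induction_on generalizing O with
  | empty =>
    obtain ⟨z, hz⟩ := hne
    simpa using hcov hz
  | @insert a J _ _ ih =>
    by_cases h : (O \ C a).Nonempty
    · obtain ⟨j, hj, z, hz⟩ := ih (fun j hj => hC j (mem_insert_of_mem _ hj))
        (hO.sdiff (hC a (mem_insert _ _))) h (fun z hz => by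
          have := hcov hz.1
          simp only [biUnion_insert, mem_union] at this
          exact this.resolve_left hz.2)
      exact ⟨j, mem_insert_of_mem _ hj, z, hz.1.1, hz.2⟩
    · have hsub : O ⊆ C a := by
        rwa [not_nonempty_iff_eq_empty, sdiff_eq_empty] at h
      obtain ⟨z, hz⟩ := hne
      exact ⟨a, mem_insert _ _, z, hz, mem_interior.2 ⟨O, hsub, hO, hz⟩⟩

/-- If finitely many relatively closed sets cover a neighbourhood of `p`, then `p` is a limit of
interior points of one of them. -/
lemma exists_mem_closure_interior {X ι : Type*} [TopologicalSpace X] {J : Set ι}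
    (hJ : J.Finite) {E : ι → Set X} {O : Set X} (hO : IsOpen O) {p : X} (hp : p ∈ O)
    (hE : ∀ j ∈ J, closure (E j) ∩ O ⊆ E j) (hcov : O ⊆ ⋃ j ∈ J, E j) :
    ∃ j ∈ J, p ∈ closure (interior (E j)) := by
  by_contra! hcon
  -- Otherwise some neighbourhood of `p` misses all the interiors, although finitely many closed
  -- sets covering it cannot all be nowhere dense there.
  have hopen : IsOpen (O ∩ ⋂ j ∈ J, (closure (interior (E j)))ᶜ) :=
    hO.inter (hJ.isOpen_biInter fun j _ => isClosed_closure.isOpen_compl)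
  obtain ⟨j, hj, z, ⟨hzO, hz⟩, hz'⟩ := exists_nonempty_interior_of_finite_cover hJ
    (C := fun j => closure (E j)) (fun j _ => isClosed_closure) hopen
    ⟨p, hp, mem_iInter₂.2 fun j hj => hcon j hj⟩
    (fun z hz => by
      obtain ⟨j, hj, h⟩ := mem_iUnion₂.1 (hcov hz.1)
      exact mem_iUnion₂.2 ⟨j, hj, subset_closure h⟩)
  refine mem_iInter₂.1 hz j hj (subset_closure ?_)
  refine mem_interior.2 ⟨interior (closure (E j)) ∩ O, fun w hw =>
    hE j hj ⟨interior_subset hw.1, hw.2⟩, isOpen_interior.inter hO, hz', hzO⟩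

/-- Branches are continuous only on their domain and arbitrary outside, so their coincidence sets
are closed only relative to that domain. -/
lemma closure_setOf_inter_subset {X Y : Type*} [TopologicalSpace X] [TopologicalSpace Y]
    {O : Set X} {f : X → Y} (hf : ∀ z ∈ O, ContinuousAt f z) {C : Set Y} (hC : IsClosed C) :
    closure {z | f z ∈ C} ∩ O ⊆ {z | f z ∈ C} := by
  rintro z ⟨hz, hzO⟩
  have hne : (𝓝[{z | f z ∈ C}] z).NeBot := mem_closure_iff_nhdsWithin_neBot.1 hz
  exact hC.mem_of_tendsto ((hf z hzO).tendsto.mono_left nhdsWithin_le_nhds)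
    (self_mem_nhdsWithin (s := {z | f z ∈ C}))

/-! ### The spherical derivative -/

/-- Near `c` the increment of `F` differs from `D (a - b)` by at most half of `‖D‖ * ‖a - b‖`, and
the latter is the exact norm of `D (a - b)`. -/
lemma exists_injOn_of_hasStrictFDerivAt {F : ℂ → ℂ} {D : ℂ →L[ℝ] ℂ} {c : ℂ}
    (h : HasStrictFDerivAt F D c) (hD : D ≠ 0) (hD' : ∀ v, ‖D v‖ = ‖D‖ * ‖v‖) :
    ∃ s ∈ 𝓝 c, InjOn F s := by
  have hD0 : 0 < ‖D‖ := norm_pos_iff.2 hD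
  have hev := h.isLittleO.def (half_pos hD0)
  rw [nhds_prod_eq, Filter.Eventually, mem_prod_self_iff] at hev
  obtain ⟨s, hs, hs'⟩ := hev
  refine ⟨s, hs, fun a ha b hb hab => ?_⟩
  have h1 := hs' (mk_mem_prod ha hb)
  rw [mem_ofPred_eq] at h1
  simp only [hab, sub_self, zero_sub, norm_neg, hD'] at h1
  by_contra hne
  have : 0 < ‖D‖ * ‖a - b‖ := mul_pos hD0 (norm_pos_iff.2 (sub_ne_zero.2 hne))
  linarith

lemma exists_injOn_of_sphDeriv_ne_zero {f : Sphere → Sphere} {p : Sphere}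
    (hf : ConformalNear f p) (h : sphDeriv f p ≠ 0) : ∃ N ∈ 𝓝 p, InjOn f N := by
  obtain ⟨s, hs, hs'⟩ := exists_injOn_of_hasStrictFDerivAt hf.analyticAt.hasStrictFDerivAt
    (fun h0 => h (by simp [sphDeriv, h0])) hf.norm_fderiv_apply
  refine ⟨chart p ⁻¹' s ∩ chartSource p, inter_mem
    ((continuousAt_chart (mem_chartSource p)).preimage_mem_nhds hs) (chartSource_mem_nhds p), ?_⟩
  rintro a ⟨ha, ha'⟩ b ⟨hb, hb'⟩ hab
  refine injOn_chart p ha' hb' (hs' ha hb ?_)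
  rw [localRep_chart ha', localRep_chart hb', hab]

@[simp] lemma coord_inversion_coe (t : ℂ) : coord (inversion (t : Sphere)) = t⁻¹ := by
  by_cases ht : t = 0
  · subst ht; simp [coord]
  · simp [inversion_coe ht]

lemma localRep_inversion_infty : localRep inversion OnePoint.infty = id := by
  ext t; simp [localRep]

lemma localRep_inversion_zero : localRep inversion ((0 : ℂ) : Sphere) = id := by
  ext t; simp [localRep]

lemma localRep_inversion_coe {z : ℂ} (hz : z ≠ 0) : localRep inversion (z : Sphere) = Inv.inv := by
  ext t; simp [localRep, inversion_coe hz]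

lemma holomorphicNear_inversion (p : Sphere) : HolomorphicNear inversion p := by
  refine ⟨continuous_inversion.continuousAt, ?_⟩
  induction p using OnePoint.rec with
  | infty => rw [localRep_inversion_infty]; exact analyticAt_id
  | coe z =>
    by_cases hz : z = 0
    · subst hz
      rw [localRep_inversion_zero]; exact analyticAt_id
    · rw [localRep_inversion_coe hz, chart_coe, coord_coe]
      exact analyticAt_inv hz

lemma conformalNear_inversion (p : Sphere) : ConformalNear inversion p :=
  .inl (holomorphicNear_inversion p)

@[simp] lemma sphDeriv_inversion (p : Sphere) : sphDeriv inversion p = 1 := by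
  induction p using OnePoint.rec with
  | infty => simp [sphDeriv, localRep_inversion_infty]
  | coe z =>
    by_cases hz : z = 0
    · subst hz
      simp [sphDeriv, localRep_inversion_zero]
    · have h1 := ((hasDerivAt_inv hz).hasFDerivAt.restrictScalars ℝ).fderiv
      have h2 : ‖fderiv ℝ (Inv.inv : ℂ → ℂ) z‖ = (‖z‖ ^ 2)⁻¹ := by
        refine ContinuousLinearMap.homothety_norm _ fun v => ?_
        rw [show fderiv ℝ (Inv.inv : ℂ → ℂ) z = _ from h1]
        simp [mul_comm]
      rw [sphDeriv, localRep_inversion_coe hz, chart_coe, coord_coe, h2, inversion_coe hz, chart_coe,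
        coord_coe, norm_inv]
      have : ‖z‖ ≠ 0 := norm_ne_zero_iff.2 hz
      field_simp
      ring

lemma holomorphicNear_id (p : Sphere) : HolomorphicNear id p := by
  refine ⟨continuousAt_id, ?_⟩
  have : localRep id p = id := by ext t; simp [localRep]
  rw [this]; exact analyticAt_id

@[simp] lemma sphDeriv_id (p : Sphere) : sphDeriv id p = 1 := by
  have : localRep id p = id := by ext t; simp [localRep]
  rw [sphDeriv, this]
  simp only [fderiv_id, ContinuousLinearMap.norm_id, id, one_mul]
  exact div_self (by positivity)

/-- At finite points with finite values the charts do not change from point to point, so a single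
coordinate formula applies nearby. -/
lemma continuousAt_sphDeriv_of_finite {f : Sphere → Sphere} {z : ℂ}
    (hf : ConformalNear f (z : Sphere)) (hfz : f (z : Sphere) ≠ OnePoint.infty) :
    ContinuousAt (sphDeriv f) (z : Sphere) := by
  rw [OnePoint.continuousAt_coe]
  have han := hf.analyticAt
  rw [chart_coe, coord_coe] at han
  have hcf : ContinuousAt (fun t : ℂ => f (t : Sphere)) z :=
    OnePoint.continuousAt_coe.1 hf.continuousAt
  have hev : (fun t : ℂ => ‖fderiv ℝ (localRep f (z : Sphere)) t‖ * (1 + ‖t‖ ^ 2) /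
      (1 + ‖coord (f (t : Sphere))‖ ^ 2)) =ᶠ[𝓝 z] sphDeriv f ∘ ((↑) : ℂ → Sphere) := by
    filter_upwards [hcf.eventually_ne hfz] with t ht
    have : localRep f (t : Sphere) = localRep f (z : Sphere) := by
      ext s
      simp [localRep, chart_of_ne ht, chart_of_ne hfz]
    simp [sphDeriv, this, chart_of_ne ht]
  refine ContinuousAt.congr ?_ hev
  have hc : ContinuousAt (fun t : ℂ => coord (f (t : Sphere))) z :=
    (continuousAt_coord hfz).comp (f := fun t : ℂ => f (t : Sphere)) hcf
  refine (ContinuousAt.mul han.fderiv.continuousAt.norm (by fun_prop)).div (by fun_prop) ?_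
  positivity

/-- The spherical derivative of an (anti)holomorphic map is continuous. -/
lemma continuousAt_sphDeriv {f : Sphere → Sphere} {p : Sphere}
    (hf : ∀ᶠ q in 𝓝 p, ConformalNear f q) : ContinuousAt (sphDeriv f) p := by
  -- The inversion is an isometry: composing with it on the left removes an infinite value, and on
  -- the right an infinite base point.
  have target : ∀ {f : Sphere → Sphere} {z : ℂ}, (∀ᶠ q in 𝓝 (z : Sphere), ConformalNear f q) →
      ContinuousAt (sphDeriv f) (z : Sphere) := by
    intro f z hf
    by_cases hfz : f (z : Sphere) = OnePoint.infty
    · have h1 : sphDeriv (inversion ∘ f) =ᶠ[𝓝 (z : Sphere)] sphDeriv f := by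
        filter_upwards [hf] with q hq
        rw [sphDeriv_comp (conformalNear_inversion _) hq, sphDeriv_inversion, one_mul]
      refine ContinuousAt.congr (continuousAt_sphDeriv_of_finite
        ((conformalNear_inversion _).comp hf.self_of_nhds) ?_) h1
      simp [hfz]
    · exact continuousAt_sphDeriv_of_finite hf.self_of_nhds hfz
  induction p using OnePoint.rec with
  | coe z => exact target hf
  | infty =>
    have ht : Tendsto inversion (𝓝 ((0 : ℂ) : Sphere)) (𝓝 OnePoint.infty) := by
      simpa using continuous_inversion.tendsto ((0 : ℂ) : Sphere)
    have h0 : ContinuousAt (sphDeriv (f ∘ inversion)) ((0 : ℂ) : Sphere) := by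
      refine target ?_
      filter_upwards [ht.eventually hf] with q hq
      exact hq.comp (conformalNear_inversion q)
    have h1 : sphDeriv (f ∘ inversion) ∘ inversion =ᶠ[𝓝 OnePoint.infty] sphDeriv f := by
      filter_upwards [hf] with q hq
      rw [Function.comp_apply, sphDeriv_comp (by rwa [inversion_inversion])
        (conformalNear_inversion _), inversion_inversion, sphDeriv_inversion, mul_one]
    refine ContinuousAt.congr (ContinuousAt.comp ?_ continuous_inversion.continuousAt) h1
    rwa [inversion_infty]

/-! ### The curve is closed -/

/-- The bihomogeneous form attached to `P`, on pairs of homogeneous coordinates. -/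
def bihomForm (P : MvPolynomial (Fin 2) ℂ) (u v : ℂ × ℂ) : ℂ :=
  ∑ m ∈ P.support, P.coeff m * (u.1 ^ m 0 * u.2 ^ (P.degreeOf 0 - m 0))
    * (v.1 ^ m 1 * v.2 ^ (P.degreeOf 1 - m 1))

lemma continuousAt_bihomForm (P : MvPolynomial (Fin 2) ℂ) {X : Type*} [TopologicalSpace X]
    {u v : X → ℂ × ℂ} {a : X} (hu : ContinuousAt u a) (hv : ContinuousAt v a) :
    ContinuousAt (fun b => bihomForm P (u b) (v b)) a := by
  unfold bihomForm
  exact tendsto_finsetSum _ fun m _ => Tendsto.mul (tendsto_const_nhds.mul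
    ((hu.fst.pow _).mul (hu.snd.pow _))) ((hv.fst.pow _).mul (hv.snd.pow _))

lemma bihomForm_smul (P : MvPolynomial (Fin 2) ℂ) (a b : ℂ) (u v : ℂ × ℂ) :
    bihomForm P (a • u) (b • v) =
      a ^ P.degreeOf 0 * b ^ P.degreeOf 1 * bihomForm P u v := by
  unfold bihomForm
  rw [Finset.mul_sum]
  refine Finset.sum_congr rfl fun m hm => ?_
  have h0 := pow_mul_pow_sub a (MvPolynomial.monomial_le_degreeOf 0 hm)
  have h1 := pow_mul_pow_sub b (MvPolynomial.monomial_le_degreeOf 1 hm)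
  simp only [Prod.smul_fst, Prod.smul_snd, smul_eq_mul, mul_pow]
  rw [← h0, ← h1]
  ring

/-- Homogeneous coordinates depending continuously on a point close to `p`. -/
lemma exists_homCoord_lift (p : Sphere) : ∃ u : Sphere → ℂ × ℂ, ContinuousAt u p ∧
    ∀ᶠ q in 𝓝 p, ∃ c : ℂ, c ≠ 0 ∧ homCoord q = c • u q := by
  induction p using OnePoint.rec with
  | infty =>
    refine ⟨fun q => (1, coord (inversion q)), continuousAt_const.prodMk ?_, ?_⟩
    · refine ContinuousAt.comp (continuousAt_coord ?_) continuous_inversion.continuousAt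
      simp
    · filter_upwards [chartSource_mem_nhds OnePoint.infty] with q hq
      rw [chartSource_infty] at hq
      induction q using OnePoint.rec with
      | infty => exact ⟨1, one_ne_zero, by simp [homCoord]⟩
      | coe z =>
        have hz : z ≠ 0 := fun h => hq (by simp [h])
        exact ⟨z, hz, by simp [homCoord, hz]⟩
  | coe z =>
    refine ⟨fun q => (coord q, 1), (continuousAt_coord (by simp)).prodMk continuousAt_const, ?_⟩
    filter_upwards [chartSource_mem_nhds (z : Sphere)] with q hq
    rw [chartSource_coe] at hq
    lift q to ℂ using hq
    exact ⟨1, one_ne_zero, by simp [homCoord]⟩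

/-- `homCoord` is not continuous at infinity. Bihomogeneity permits replacing it by a local
continuous lift, which changes the value by a nonzero factor only. -/
lemma isClosed_bihomEval (P : MvPolynomial (Fin 2) ℂ) :
    IsClosed {a : Sphere × Sphere | bihomEval P a.1 a.2 = 0} := by
  rw [← isOpen_compl_iff, isOpen_iff_mem_nhds]
  rintro ⟨p, q⟩ hpq
  obtain ⟨u, hu, hu'⟩ := exists_homCoord_lift p
  obtain ⟨v, hv, hv'⟩ := exists_homCoord_lift q
  have key : ∀ p' q' : Sphere, (∃ c : ℂ, c ≠ 0 ∧ homCoord p' = c • u p') →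
      (∃ c : ℂ, c ≠ 0 ∧ homCoord q' = c • v q') →
      (bihomEval P p' q' = 0 ↔ bihomForm P (u p') (v q') = 0) := by
    rintro p' q' ⟨a, ha, ha'⟩ ⟨b, hb, hb'⟩
    have : bihomEval P p' q' = bihomForm P (homCoord p') (homCoord q') := rfl
    rw [this, ha', hb', bihomForm_smul]
    simp [ha, hb]
  have hc : ContinuousAt (fun a : Sphere × Sphere => bihomForm P (u a.1) (v a.2)) (p, q) :=
    continuousAt_bihomForm P (u := fun a : Sphere × Sphere => u a.1)
      (v := fun a : Sphere × Sphere => v a.2)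
      (hu.tendsto.comp (continuous_fst.tendsto (p, q)))
      (hv.tendsto.comp (continuous_snd.tendsto (p, q)))
  have hne : bihomForm P (u p) (v q) ≠ 0 := fun h =>
    hpq ((key p q hu'.self_of_nhds hv'.self_of_nhds).2 h)
  filter_upwards [hc.eventually_ne hne, continuousAt_fst.eventually hu',
    continuousAt_snd.eventually hv'] with a ha h1 h2 h3
  exact ha ((key a.1 a.2 h1 h2).1 h3)

namespace Correspondence

variable (F : Correspondence)

lemma isClosed_graph : IsClosed F.graph := by
  have hc : Continuous fun a : Sphere × Sphere =>
      ((if F.anti then sphConj a.1 else a.1, a.2) : Sphere × Sphere) := by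
    have h : Continuous sphConj := by
      refine OnePoint.continuous_map Complex.continuous_conj ?_
      rw [coclosedCompact_eq_cocompact]
      exact Complex.conjCLE.toHomeomorph.isClosedEmbedding.tendsto_cocompact
    split_ifs <;> fun_prop
  exact (isClosed_bihomEval F.poly).preimage hc

/-- Finiteness of the fibre excludes that the polynomial in `w` vanishes identically; the fibre then
consists of its roots and possibly infinity, whence the `+ 1`. -/
lemma finite_image_encard_le {y : Sphere} (hy : (F.image y).Finite) :
    (F.image y).encard ≤ F.poly.degreeOf 1 + 1 := by
  classical
  set P := F.poly
  set u := homCoord (if F.anti then sphConj y else y)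
  set q : Polynomial ℂ := ∑ m ∈ P.support,
    Polynomial.C (P.coeff m * (u.1 ^ m 0 * u.2 ^ (P.degreeOf 0 - m 0))) * Polynomial.X ^ m 1
    with hq
  have hmem : ∀ w : ℂ, (w : Sphere) ∈ F.image y ↔ q.eval w = 0 := by
    intro w
    have : q.eval w = bihomEval P (if F.anti then sphConj y else y) (w : Sphere) := by
      simp [hq, bihomEval, Polynomial.eval_finsetSum, homCoord, u]
    rw [this]
    rfl
  have hq0 : q ≠ 0 := by
    intro h0
    refine Set.infinite_of_injective_forall_mem (OnePoint.coe_injective (X := ℂ))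
      (fun w => (hmem w).2 (by simp [h0])) hy
  have hdeg : q.natDegree ≤ P.degreeOf 1 := by
    refine Polynomial.natDegree_sum_le_of_forall_le _ _ fun m hm => ?_
    exact (Polynomial.natDegree_C_mul_X_pow_le _ _).trans (MvPolynomial.monomial_le_degreeOf 1 hm)
  have hsub : F.image y ⊆
      insert OnePoint.infty ((↑) '' (q.roots.toFinset : Set ℂ) : Set Sphere) := by
    intro w hw
    induction w using OnePoint.rec with
    | infty => exact mem_insert _ _
    | coe z => exact mem_insert_of_mem _ ⟨z, by simpa [hq0] using (hmem z).1 hw, rfl⟩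
  refine (encard_le_encard hsub).trans ((encard_insert_le _ _).trans ?_)
  gcongr
  refine (encard_image_le _ _).trans ?_
  rw [encard_coe_eq_coe_finsetCard]
  exact_mod_cast (Multiset.toFinset_card_le _).trans ((Polynomial.card_roots' q).trans hdeg)

lemma iter_succ (n : ℕ) (z : Sphere) : F.iter (n + 1) z = ⋃ y ∈ F.iter n z, F.image y := rfl

lemma image_subset_iter_succ {n : ℕ} {y z : Sphere} (hy : y ∈ F.iter n z) :
    F.image y ⊆ F.iter (n + 1) z := subset_biUnion_of_mem (u := F.image) hy

lemma ncard_iter_le {z : Sphere} (hfin : ∀ n, (F.iter n z).Finite) (n : ℕ) :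
    (F.iter n z).ncard ≤ (F.poly.degreeOf 1 + 1) ^ n := by
  classical
  induction n with
  | zero => simp [iter]
  | succ n ih =>
    have him : ∀ y ∈ F.iter n z, (F.image y).Finite := fun y hy =>
      (hfin (n + 1)).subset (F.image_subset_iter_succ hy)
    set T : Sphere → Finset Sphere := fun y =>
      if h : (F.image y).Finite then h.toFinset else ∅
    have hT : ∀ y ∈ F.iter n z, (T y : Set Sphere) = F.image y := fun y hy => by
      simp [T, him y hy]
    have hset : F.iter (n + 1) z = ((hfin n).toFinset.biUnion T : Finset Sphere) := by
      rw [iter_succ, Finset.coe_biUnion]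
      ext w
      simp only [mem_iUnion, Finite.coe_toFinset, exists_prop]
      exact exists_congr fun y => and_congr_right fun hy => by rw [hT y hy]
    rw [hset, ncard_coe_finset]
    refine (Finset.card_biUnion_le_card_mul _ _ (F.poly.degreeOf 1 + 1) fun y hy => ?_).trans ?_
    · have hy' : y ∈ F.iter n z := by simpa using hy
      have := F.finite_image_encard_le (him y hy')
      rw [← hT y hy', encard_coe_eq_coe_finsetCard] at this
      exact_mod_cast this
    · rw [pow_succ]
      gcongr
      rwa [← ncard_eq_toFinset_card _ (hfin n)]

end Correspondence

/-! ### Germs of branches -/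

lemma IsBranchOn.conformalNear {G : Sphere → Set Sphere} {U : Set Sphere} {f : Sphere → Sphere}
    (h : IsBranchOn G U f) {p : Sphere} (hp : p ∈ U) : ConformalNear f p :=
  h.1.imp (fun h => h p hp) (fun h => h p hp)

lemma IsBranchOn.mono {G : Sphere → Set Sphere} {U V : Set Sphere} {f : Sphere → Sphere}
    (h : IsBranchOn G U f) (hV : V ⊆ U) : IsBranchOn G V f :=
  ⟨h.1.imp (fun h p hp => h p (hV hp)) (fun h p hp => h p (hV hp)), fun p hp => h.2 p (hV hp)⟩

/-- The germs at `x` of the branches of `G` defined near `x`. -/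
def germBranches (G : Sphere → Set Sphere) (x : Sphere) : Set (Germ (𝓝 x) Sphere) :=
  {γ | ∃ (f : Sphere → Sphere) (V : Set Sphere), IsOpen V ∧ x ∈ V ∧ IsBranchOn G V f ∧
    (f : Germ (𝓝 x) Sphere) = γ}

/-- The spherical derivative of a germ at its base point. -/
def germDeriv {x : Sphere} (γ : Germ (𝓝 x) Sphere) : ℝ≥0∞ :=
  γ.liftOn (fun f => ENNReal.ofReal (sphDeriv f x)) fun _ _ h =>
    congrArg ENNReal.ofReal (sphDeriv_congr h)

@[simp] lemma germDeriv_coe {x : Sphere} (f : Sphere → Sphere) :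
    germDeriv (f : Germ (𝓝 x) Sphere) = ENNReal.ofReal (sphDeriv f x) := rfl

lemma germDeriv_ne_top {x : Sphere} (γ : Germ (𝓝 x) Sphere) : germDeriv γ ≠ ∞ := by
  induction γ using Filter.Germ.inductionOn with
  | h f => simp

lemma germ_mem_germBranches {G : Sphere → Set Sphere} {U : Set Sphere} {f : Sphere → Sphere}
    {x : Sphere} (hU : IsOpen U) (hx : x ∈ U) (hf : IsBranchOn G U f) :
    (f : Germ (𝓝 x) Sphere) ∈ germBranches G x := ⟨f, U, hU, hx, hf, rfl⟩

lemma value_mem {G : Sphere → Set Sphere} {x : Sphere} {γ : Germ (𝓝 x) Sphere}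
    (hγ : γ ∈ germBranches G x) : γ.value ∈ G x := by
  obtain ⟨f, V, _, hx, hf, rfl⟩ := hγ
  exact hf.2 x hx

lemma eq_of_germ_eq {G : Sphere → Set Sphere} {U : Set Sphere} {x : Sphere}
    (hU : IsConnected U) (hx : x ∈ U) {f g : Sphere → Sphere} (hf : f ∈ branches G U)
    (hg : g ∈ branches G U) (h : f =ᶠ[𝓝 x] g) : f = g := by
  ext1 p
  by_cases hp : p ∈ U
  · exact eqOn_of_conformalNear hU.isPreconnected (fun q hq => hf.1.conformalNear hq)
      (fun q hq => hg.1.conformalNear hq) hx h hp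
  · rw [hf.2 p hp, hg.2 p hp]

/-- On a branch domain, a branch is the same thing as its germ at a point. -/
def branchesEquivGerms {G : Sphere → Set Sphere} {U : Set Sphere} {x : Sphere} (hU : IsOpen U)
    (hU' : IsConnected U) (hx : x ∈ U) (hG : AllBranchesDefined G U) :
    branches G U ≃ germBranches G x :=
  Equiv.ofBijective
    (fun f => ⟨(f.1 : Germ (𝓝 x) Sphere), germ_mem_germBranches hU hx f.2.1⟩) (by
      constructor
      · rintro ⟨f, hf⟩ ⟨g, hg⟩ h
        simp only [Subtype.mk.injEq, Germ.coe_eq] at h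
        exact Subtype.ext (eq_of_germ_eq hU' hx hf hg h)
      · rintro ⟨_, f, V, hV, hxV, hf, rfl⟩
        -- At each point the local branch `f` takes the value of one of the finitely many branches
        -- on `U`, so it agrees with one of them on open sets accumulating at `x`.
        obtain ⟨j, hj, hjx⟩ := exists_mem_closure_interior hG.1 (O := U ∩ V) (hU.inter hV)
          (p := x) ⟨hx, hxV⟩ (E := fun g => {z | g z = f z})
          (fun g hg => by
            have := closure_setOf_inter_subset (f := fun z => (g z, f z)) (O := U ∩ V)
              (fun z hz => (hg.1.conformalNear hz.1).continuousAt.prodMk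
                (hf.conformalNear hz.2).continuousAt) isClosed_diagonal
            simpa only [mem_diagonal_iff] using this)
          (fun z hz => by
            have := hf.2 z hz.2
            rw [hG.2 z hz.1] at this
            obtain ⟨g, hg, hgz⟩ := this
            exact mem_iUnion₂.2 ⟨g, hg, hgz⟩)
        refine ⟨⟨j, hj⟩, Subtype.ext (Germ.coe_eq.2 ?_)⟩
        exact (hj.1.conformalNear hx).eventuallyEq (hf.conformalNear hxV) hjx)

/-- Finitely many branches on a connected open set take distinct values at some point. -/
lemma exists_injOn_eval {G : Sphere → Set Sphere} {U : Set Sphere} {x : Sphere} (hU : IsOpen U)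
    (hU' : IsConnected U) (hx : x ∈ U) (hfin : (branches G U).Finite) :
    ∃ z ∈ U, InjOn (fun f : Sphere → Sphere => f z) (branches G U) := by
  by_contra! hcon
  -- If two distinct branches met at every point, the coincidence sets of the finitely many pairs
  -- would cover `U`, and some pair would have the same germ at `x`.
  obtain ⟨j, hj, hjx⟩ := exists_mem_closure_interior
    (J := (branches G U).offDiag) (hfin.offDiag)
    hU hx (E := fun j => {z | j.1 z = j.2 z})
    (fun j hj => by
      have := closure_setOf_inter_subset (f := fun z => (j.1 z, j.2 z)) (O := U)
        (fun z hz => (hj.1.1.conformalNear hz).continuousAt.prodMk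
          (hj.2.1.1.conformalNear hz).continuousAt) isClosed_diagonal
      simpa only [mem_diagonal_iff] using this)
    (fun z hz => by
      have := hcon z hz
      simp only [InjOn, not_forall] at this
      obtain ⟨f, hf, g, hg, hfg, hne⟩ := this
      exact mem_iUnion₂.2 ⟨(f, g), ⟨hf, hg, hne⟩, hfg⟩)
  exact hj.2.2 (eq_of_germ_eq hU' hx hj.1 hj.2.1
    ((hj.1.1.conformalNear hx).eventuallyEq (hj.2.1.1.conformalNear hx) hjx))

namespace Correspondence

variable {F : Correspondence}

/-- The definition requires `n ≥ 1`; at level `0` the identity is the only branch. -/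
lemma IsBranchDomain.allBranchesDefined {x : Sphere} {U : Set Sphere} (h : F.IsBranchDomain x U)
    (n : ℕ) : AllBranchesDefined (F.iter n) U := by
  classical
  rcases Nat.eq_zero_or_pos n with rfl | hn
  · have hsub : (branches (F.iter 0) U).Subsingleton := by
      intro f hf g hg
      ext1 p
      by_cases hp : p ∈ U
      · have h1 : f p ∈ ({p} : Set Sphere) := hf.1.2 p hp
        have h2 : g p ∈ ({p} : Set Sphere) := hg.1.2 p hp
        rw [mem_singleton_iff.1 h1, mem_singleton_iff.1 h2]
      · rw [hf.2 p hp, hg.2 p hp]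
    refine ⟨hsub.finite, fun z hz => ?_⟩
    have hmem : U.piecewise id (fun _ => OnePoint.infty) ∈ branches (F.iter 0) U := by
      refine ⟨⟨.inl fun p hp => (holomorphicNear_id p).congr ?_, fun p hp => ?_⟩, fun p hp => ?_⟩
      · filter_upwards [h.1.mem_nhds hp] with q hq
        simp [hq]
      · simp [iter, hp]
      · simp [hp]
    ext w
    constructor
    · intro hw
      have hw' : w = z := hw
      exact ⟨_, hmem, by simp [hz, hw']⟩
    · rintro ⟨f, hf, rfl⟩
      exact hf.1.2 z hz
  · exact h.2.2.2 n hn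

lemma IsBranchDomain.finite_germBranches {x : Sphere} {U : Set Sphere}
    (h : F.IsBranchDomain x U) (n : ℕ) : Finite (germBranches (F.iter n) x) := by
  have := (h.allBranchesDefined n).1.to_subtype
  exact Finite.of_equiv _ (branchesEquivGerms h.1 h.2.1 h.2.2.1 (h.allBranchesDefined n))

lemma IsBranchDomain.finite_iter {x : Sphere} {U : Set Sphere} (h : F.IsBranchDomain x U) (n : ℕ)
    {z : Sphere} (hz : z ∈ U) : (F.iter n z).Finite := by
  rw [(h.allBranchesDefined n).2 z hz]
  exact (h.allBranchesDefined n).1.image fun f : Sphere → Sphere => f z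

/-- Branches are counted by their values at a point where these are distinct. This exponential bound
is the only growth information used for the modified series. -/
lemma IsBranchDomain.card_germBranches_le {x : Sphere} {U : Set Sphere}
    (h : F.IsBranchDomain x U) (n : ℕ) :
    Nat.card (germBranches (F.iter n) x) ≤ (F.poly.degreeOf 1 + 1) ^ n := by
  have hab := h.allBranchesDefined n
  rw [← Nat.card_congr (branchesEquivGerms h.1 h.2.1 h.2.2.1 hab), Nat.card_coe_set_eq]
  obtain ⟨z, hz, hinj⟩ := exists_injOn_eval h.1 h.2.1 h.2.2.1 hab.1
  refine le_trans ?_ (F.ncard_iter_le (fun n => h.finite_iter n hz) n)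
  exact ncard_le_ncard_of_injOn _ (fun f hf => hf.1.2 z hz) hinj (h.finite_iter n hz)

/-- The weighted sum of the values of `φ` at the points `γ(x)`, over the germs `γ` of branches of
`F^n` at `x`, with weights `|Dγ(x)| ^ t(n)`. -/
def germSum (F : Correspondence) (x : Sphere) (t : ℕ → ℝ) (φ : Sphere → ℝ≥0∞) : ℝ≥0∞ :=
  ∑' n : ℕ, ∑' γ : germBranches (F.iter n) x, germDeriv γ.1 ^ t n * φ γ.1.value

/-- Reindexing by germs is the source of the independence of `U`. -/
lemma IsBranchDomain.tsum_branches {x : Sphere} {U : Set Sphere} (h : F.IsBranchDomain x U)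
    (t : ℕ → ℝ) (φ : Sphere → ℝ≥0∞) :
    ∑' n : ℕ, ∑' f : branches (F.iter n) U,
      ENNReal.ofReal (sphDeriv f.1 x) ^ t n * φ (f.1 x) = F.germSum x t φ := by
  refine tsum_congr fun n => ?_
  exact (branchesEquivGerms h.1 h.2.1 h.2.2.1 (h.allBranchesDefined n)).tsum_eq
    (fun γ : germBranches (F.iter n) x => germDeriv γ.1 ^ t n * φ γ.1.value)

lemma IsBranchDomain.weightedSeries_eq {x : Sphere} {U : Set Sphere} (h : F.IsBranchDomain x U)
    (t : ℕ → ℝ) : F.weightedSeries x U t = F.germSum x t fun _ => 1 := by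
  rw [← h.tsum_branches]
  simp [weightedSeries]

lemma IsBranchDomain.poincareSeries_eq {x : Sphere} {U : Set Sphere} (h : F.IsBranchDomain x U)
    (s : ℝ) : F.poincareSeries x s = F.germSum x (fun _ => s) fun _ => 1 := by
  refine le_antisymm ((iInf₂_le U h).trans_eq (h.weightedSeries_eq _)) ?_
  exact le_iInf₂ fun U' h' => (h'.weightedSeries_eq _).ge

lemma IsBranchDomain.lintegral_psMeasure {x : Sphere} {U : Set Sphere}
    (h : F.IsBranchDomain x U) (t : ℕ → ℝ) (φ : Sphere → ℝ≥0∞) :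
    ∫⁻ z, φ z ∂(F.psMeasure x U t) =
      (F.germSum x t fun _ => 1)⁻¹ * F.germSum x t φ := by
  rw [psMeasure, lintegral_smul_measure, smul_eq_mul, h.weightedSeries_eq, lintegral_sum_measure]
  congr 1
  rw [← h.tsum_branches]
  refine tsum_congr fun n => ?_
  rw [lintegral_sum_measure]
  refine tsum_congr fun f => ?_
  rw [lintegral_smul_measure, lintegral_dirac, smul_eq_mul]

end Correspondence

namespace Correspondence

/-! ### Transport of germs by a branch of the correspondence -/

variable {F : Correspondence}

lemma InvariantlyInverseLike.iter_subset {S : Set Sphere} (hF : F.InvariantlyInverseLike S)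
    {x : Sphere} (hx : x ∈ S) (n : ℕ) : F.iter n x ⊆ S := by
  induction n with
  | zero => simpa [iter] using hx
  | succ n ih =>
    exact iUnion₂_subset fun y hy =>
      (subset_biUnion_of_mem (u := F.image) (ih hy)).trans hF.1

lemma InvariantlyInverseLike.limitSet_subset {S : Set Sphere} (hF : F.InvariantlyInverseLike S)
    (hS : IsClosed S) {x : Sphere} (hx : x ∈ S) : F.limitSet x ⊆ S :=
  (iInter_subset _ 0).trans (closure_minimal (iUnion₂_subset fun n _ => hF.iter_subset hx n) hS)

lemma InvariantlyInverseLike.eq_of_mem_image {S : Set Sphere} (hF : F.InvariantlyInverseLike S)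
    {y z w : Sphere} (hy : y ∈ S) (hz : z ∈ S) (hyw : w ∈ F.image y) (hzw : w ∈ F.image z) :
    y = z :=
  (hF.2 w (mem_biUnion hy hyw)).unique ⟨hy, hyw⟩ ⟨hz, hzw⟩

lemma isClosed_limitSet (F : Correspondence) (x : Sphere) : IsClosed (F.limitSet x) :=
  isClosed_iInter fun _ => isClosed_closure

/-- Near a nonsingular point `a` of `S`, all of `F` in `S` with values near `f a` is given by
the branch `f`. -/
lemma exists_nhds_branch {S : Set Sphere} (hS : IsClosed S) (hF : F.InvariantlyInverseLike S)
    {a : Sphere} (haS : a ∈ S) (ha : a ∉ F.sing) {V : Set Sphere} (hV : IsOpen V) (haV : a ∈ V)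
    {f : Sphere → Sphere} (hf : IsBranchOn F.image V f) {W₁ : Set Sphere} (hW₁ : W₁ ∈ 𝓝 a) :
    ∃ W N : Set Sphere, IsOpen W ∧ IsOpen N ∧ a ∈ W ∧ f a ∈ N ∧ W ⊆ V ∩ W₁ ∧
      (∀ y ∈ S, ∀ w ∈ F.image y, w ∈ N → y ∈ W) ∧
      (∀ y ∈ W, ∀ w ∈ F.image y, w ∈ N → w = f y) := by
  have hab : f a ∈ F.image a := hf.2 a haV
  -- Nonsingularity makes the curve near `(a, f a)` the graph of a single-valued map, necessarily
  -- `f`.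
  obtain ⟨O, hO, hinj⟩ : ∃ O ∈ 𝓝 (a, f a), InjOn Prod.fst (F.graph ∩ O) := by
    by_contra! hcon
    exact ha ⟨(a, f a), ⟨hab, hcon⟩, rfl⟩
  obtain ⟨W₀, N₀, hW₀, haW₀, hN₀, hbN₀, hWN⟩ := mem_nhds_prod_iff'.1 hO
  have hfc := (hf.conformalNear haV).continuousAt
  obtain ⟨W, hWsub, hW, haW⟩ := mem_nhds_iff.1 (inter_mem (inter_mem (hV.mem_nhds haV) hW₁)
    (inter_mem (hW₀.mem_nhds haW₀) (hfc (hN₀.mem_nhds hbN₀))))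
  -- `K` consists of the values of `F` at points of `S` away from `a`. It is closed by compactness,
  -- and it omits `f a` because `a` is the only preimage of `f a` in `S`.
  set K : Set Sphere := Prod.snd '' (F.graph ∩ ((S \ W) ×ˢ univ)) with hK
  have hKc : IsClosed K :=
    ((F.isClosed_graph.inter ((hS.sdiff hW).prod isClosed_univ)).isCompact.image
      continuous_snd).isClosed
  have hbK : f a ∉ K := by
    rintro ⟨⟨y, w⟩, ⟨hyw, ⟨hyS, hyW⟩, -⟩, rfl : w = f a⟩
    exact hyW (hF.eq_of_mem_image haS hyS hab hyw ▸ haW)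
  refine ⟨W, N₀ ∩ Kᶜ, hW, hN₀.inter hKc.isOpen_compl, haW, ⟨hbN₀, hbK⟩,
    fun y hy => (hWsub hy).1, fun y hyS w hyw hw => ?_, fun y hy w hyw hw => ?_⟩
  · by_contra hyW
    exact hw.2 ⟨(y, w), ⟨hyw, ⟨hyS, hyW⟩, trivial⟩, rfl⟩
  · have h := hWsub hy
    have h1 : (y, w) ∈ F.graph ∩ O := ⟨hyw, hWN ⟨h.2.1, hw.1⟩⟩
    have h2 : (y, f y) ∈ F.graph ∩ O := ⟨hf.2 y h.1.1, hWN ⟨h.2.1, h.2.2⟩⟩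
    exact congrArg Prod.snd (hinj h1 h2 rfl)

lemma _root_.AlgCorr.IsBranchOn.comp_iter {V V' : Set Sphere} {f g : Sphere → Sphere} {n : ℕ}
    (hf : IsBranchOn F.image V f) (hg : IsBranchOn (F.iter n) V' g) (hV' : MapsTo g V' V) :
    IsBranchOn (F.iter (n + 1)) V' (f ∘ g) := by
  refine ⟨?_, fun p hp => F.image_subset_iter_succ (hg.2 p hp) (hf.2 _ (hV' hp))⟩
  rcases hf.1 with h | h <;> rcases hg.1 with h' | h'
  · exact .inl fun p hp => (h _ (hV' hp)).comp (h' p hp)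
  · exact .inr fun p hp => (h _ (hV' hp)).comp_antiholomorphic (h' p hp)
  · exact .inr fun p hp => (h _ (hV' hp)).comp_holomorphic (h' p hp)
  · exact .inl fun p hp => (h _ (hV' hp)).comp (h' p hp)

lemma map_mem_germBranches {x : Sphere} {V : Set Sphere} (hV : IsOpen V) {f : Sphere → Sphere}
    (hf : IsBranchOn F.image V f) {n : ℕ} {γ : Germ (𝓝 x) Sphere}
    (hγ : γ ∈ germBranches (F.iter n) x) (hγV : γ.value ∈ V) :
    γ.map f ∈ germBranches (F.iter (n + 1)) x := by
  obtain ⟨g, V', hV', hxV', hg, rfl⟩ := hγ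
  refine ⟨f ∘ g, V' ∩ g ⁻¹' V, ?_, ⟨hxV', hγV⟩, ?_, rfl⟩
  · exact ContinuousOn.isOpen_inter_preimage
      (fun p hp => (hg.conformalNear hp).continuousAt.continuousWithinAt) hV' hV
  · exact hf.comp_iter (hg.mono inter_subset_left) fun p hp => hp.2

lemma germDeriv_map {x : Sphere} {V : Set Sphere} {f : Sphere → Sphere}
    (hf : IsBranchOn F.image V f) {n : ℕ} {γ : Germ (𝓝 x) Sphere}
    (hγ : γ ∈ germBranches (F.iter n) x) (hγV : γ.value ∈ V) :
    germDeriv (γ.map f) = ENNReal.ofReal (sphDeriv f γ.value) * germDeriv γ := by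
  obtain ⟨g, V', hV', hxV', hg, rfl⟩ := hγ
  rw [Germ.map_coe, germDeriv_coe, germDeriv_coe, Germ.value_ofFun,
    ← ENNReal.ofReal_mul (sphDeriv_nonneg _ _),
    sphDeriv_comp (hf.conformalNear hγV) (hg.conformalNear hxV')]

lemma value_map {x : Sphere} (f : Sphere → Sphere) (γ : Germ (𝓝 x) Sphere) :
    (γ.map f).value = f γ.value := by
  induction γ using Filter.Germ.inductionOn with
  | h g => rfl

/-- A germ of a branch of `F^{n+1}` with value near `f a` factors through the branch `f`. -/
lemma IsBranchDomain.exists_map_eq {S : Set Sphere} (hF : F.InvariantlyInverseLike S)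
    {x : Sphere} (hx : x ∈ S) {U : Set Sphere} (hU : F.IsBranchDomain x U) {V W N : Set Sphere}
    {f : Sphere → Sphere} (hf : IsBranchOn F.image V f) (hW : IsOpen W) (hN : IsOpen N)
    (hWV : W ⊆ V) (h1 : ∀ y ∈ S, ∀ w ∈ F.image y, w ∈ N → y ∈ W)
    (h2 : ∀ y ∈ W, ∀ w ∈ F.image y, w ∈ N → w = f y) {n : ℕ} {η : Germ (𝓝 x) Sphere}
    (hη : η ∈ germBranches (F.iter (n + 1)) x) (hηN : η.value ∈ N) :
    ∃ γ ∈ germBranches (F.iter n) x, γ.value ∈ W ∧ γ.map f = η := by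
  obtain ⟨h, V', hV', hxV', hh, rfl⟩ := hη
  have hxU : x ∈ U := hU.2.2.1
  have hab := hU.allBranchesDefined n
  have hcl : ∀ j ∈ branches (F.iter n) U,
      closure {z | (j z, h z) ∈ F.graph} ∩ (U ∩ V') ⊆ {z | (j z, h z) ∈ F.graph} := fun j hj =>
    closure_setOf_inter_subset (f := fun z => (j z, h z)) (O := U ∩ V')
      (fun z hz => (hj.1.conformalNear hz.1).continuousAt.prodMk
        (hh.conformalNear hz.2).continuousAt) F.isClosed_graph
  -- The branch of `F^n` through which `h` factors could vary with the point. One branch `j` works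
  -- on open sets accumulating at `x`, and closedness of the curve extends the relation to `x`
  -- itself.
  obtain ⟨j, hj, hjx⟩ := exists_mem_closure_interior hab.1 (O := U ∩ V') (hU.1.inter hV')
    (p := x) ⟨hxU, hxV'⟩ (E := fun j => {z | (j z, h z) ∈ F.graph}) hcl
    (fun z hz => by
      obtain ⟨y, hy, hyz⟩ := mem_iUnion₂.1 (hh.2 z hz.2)
      rw [hab.2 z hz.1] at hy
      obtain ⟨g, hg, rfl⟩ := hy
      exact mem_iUnion₂.2 ⟨g, hg, hyz⟩)
  have hjc := (hj.1.conformalNear hxU).continuousAt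
  have hhc := (hh.conformalNear hxV').continuousAt
  have hgr : h x ∈ F.image (j x) :=
    hcl j hj ⟨closure_mono interior_subset hjx, hxU, hxV'⟩
  have hjW : j x ∈ W := h1 _ (hF.iter_subset hx n (hj.1.2 x hxU)) _ hgr hηN
  refine ⟨j, germ_mem_germBranches hU.1 hxU hj.1, hjW, ?_⟩
  rw [Germ.map_coe, Germ.coe_eq]
  refine ConformalNear.eventuallyEq
    ((hf.conformalNear (hWV hjW)).comp (hj.1.conformalNear hxU)) (hh.conformalNear hxV') ?_
  obtain ⟨O, hO, hOopen, hxO⟩ := mem_nhds_iff.1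
    (inter_mem (hjc (hW.mem_nhds hjW)) (hhc (hN.mem_nhds hηN)))
  have := hOopen.closure_inter ⟨hjx, hxO⟩
  refine closure_mono (interior_maximal ?_ (isOpen_interior.inter hOopen)) this
  rintro z ⟨hz, hzO⟩
  have hz' : z ∈ {z | (j z, h z) ∈ F.graph} := interior_subset hz
  exact (h2 _ (hO hzO).1 _ hz' (hO hzO).2).symm

/-- Transport of a weighted sum over germs by a branch `f`. -/
lemma IsBranchDomain.tsum_germBranches_succ {S : Set Sphere} (hF : F.InvariantlyInverseLike S)
    {x : Sphere} (hx : x ∈ S) {U : Set Sphere} (hU : F.IsBranchDomain x U) {V W N : Set Sphere}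
    (hV : IsOpen V)
    {f : Sphere → Sphere} (hf : IsBranchOn F.image V f) (hW : IsOpen W) (hN : IsOpen N)
    (hWV : W ⊆ V) (h1 : ∀ y ∈ S, ∀ w ∈ F.image y, w ∈ N → y ∈ W)
    (h2 : ∀ y ∈ W, ∀ w ∈ F.image y, w ∈ N → w = f y) {φ ψ : Sphere → ℝ≥0∞} {t : ℝ} (ht : 0 < t)
    (hφ : ∀ w ∉ N, φ w = 0)
    (hψ : ∀ y ∈ W, ψ y = ENNReal.ofReal (sphDeriv f y) ^ t * φ (f y))
    (hψ' : ∀ y ∈ S \ W, ψ y = 0) (n : ℕ) :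
    ∑' γ : germBranches (F.iter (n + 1)) x, germDeriv γ.1 ^ t * φ γ.1.value =
      ∑' γ : germBranches (F.iter n) x, germDeriv γ.1 ^ t * ψ γ.1.value := by
  have hS : ∀ γ : germBranches (F.iter n) x, γ.1.value ∈ S := fun γ =>
    hF.iter_subset hx n (value_mem γ.2)
  set R : germBranches (F.iter n) x → ℝ≥0∞ := fun γ => germDeriv γ.1 ^ t * ψ γ.1.value with hR
  have hsupp : ∀ γ : Function.support R, γ.1.1.value ∈ W := fun γ => by
    by_contra hγ
    exact γ.2 (by simp [hR, hψ' _ ⟨hS γ.1, hγ⟩])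
  have hmapT : ∀ γ : germBranches (F.iter n) x, γ.1.value ∈ W →
      germDeriv (γ.1.map f) ^ t * φ (γ.1.map f).value = R γ := fun γ hγ => by
    rw [germDeriv_map hf γ.2 (hWV hγ), value_map, ENNReal.mul_rpow_of_nonneg _ _ ht.le]
    simp only [hR, hψ _ hγ]
    ring
  -- Only nonzero terms are matched: where `Df` vanishes, composition with `f` need not be injective
  -- on germs.
  refine tsum_eq_tsum_of_ne_zero_bij
    (fun γ : Function.support R =>
      ⟨γ.1.1.map f, map_mem_germBranches hV hf γ.1.2 (hWV (hsupp γ))⟩) ?_ ?_ ?_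
  · rintro ⟨⟨γ₁, hγ₁⟩, h₁⟩ ⟨⟨γ₂, hγ₂⟩, h₂⟩ h
    simp only [Subtype.mk.injEq] at h ⊢
    have w₁ : γ₁.value ∈ W := hsupp ⟨⟨γ₁, hγ₁⟩, h₁⟩
    have w₂ : γ₂.value ∈ W := hsupp ⟨⟨γ₂, hγ₂⟩, h₂⟩
    have s₁ : γ₁.value ∈ S := hS ⟨γ₁, hγ₁⟩
    have s₂ : γ₂.value ∈ S := hS ⟨γ₂, hγ₂⟩
    -- Inverse-likeness identifies the values of the two germs; local injectivity of `f` at that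
    -- point then identifies the germs.
    have hval : γ₁.value = γ₂.value := by
      have h' := congrArg Germ.value h
      rw [value_map, value_map] at h'
      exact hF.eq_of_mem_image s₁ s₂ (hf.2 _ (hWV w₁)) (h' ▸ hf.2 _ (hWV w₂))
    -- A critical point would give a zero term, since the exponent `t` is positive.
    have hd : sphDeriv f γ₁.value ≠ 0 := by
      intro h0
      refine h₁ ?_
      simp only [hψ _ w₁, h0, ENNReal.ofReal_zero, ENNReal.zero_rpow_of_pos ht]
      simp
    obtain ⟨O, hO, hinj⟩ := exists_injOn_of_sphDeriv_ne_zero (hf.conformalNear (hWV w₁)) hd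
    obtain ⟨g₁, V₁, _, hx₁, hg₁, rfl⟩ := hγ₁
    obtain ⟨g₂, V₂, _, hx₂, hg₂, rfl⟩ := hγ₂
    simp only [Germ.map_coe, Germ.coe_eq, Germ.value_ofFun] at h hval hO ⊢
    filter_upwards [h, (hg₁.conformalNear hx₁).continuousAt hO,
      (hg₂.conformalNear hx₂).continuousAt (hval ▸ hO)] with z hz hz₁ hz₂
    exact hinj hz₁ hz₂ hz
  · rintro ⟨η, hη⟩ hne
    have hηN : η.value ∈ N := by
      by_contra h
      exact hne (by simp [hφ _ h])
    obtain ⟨γ, hγ, hγW, rfl⟩ := hU.exists_map_eq hF hx hf hW hN hWV h1 h2 hη hηN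
    refine ⟨⟨⟨γ, hγ⟩, ?_⟩, rfl⟩
    exact fun h0 => hne ((hmapT ⟨γ, hγ⟩ hγW).trans h0)
  · intro γ
    exact hmapT γ.1 (hsupp γ)

end Correspondence

/-! ### Exponent estimates -/

/-- Powers decrease or increase in the exponent according to the side of `1`; derivatives of
branches may lie on either side, so both endpoints are kept. -/
lemma rpow_le_rpow_add_rpow (a : ℝ≥0∞) {s t u : ℝ} (hs : s ≤ t) (hu : t ≤ u) :
    a ^ t ≤ a ^ s + a ^ u := by
  rcases le_total a 1 with h | h
  · exact (ENNReal.rpow_le_rpow_of_exponent_ge h hs).trans le_self_add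
  · exact (ENNReal.rpow_le_rpow_of_exponent_le h hu).trans le_add_self

/-- Positivity of `δ` matters at `a = 0`, where the power jumps at exponent `0`. -/
lemma tendsto_const_rpow {a : ℝ≥0∞} (ha : a ≠ ∞) {δ : ℝ} (hδ : 0 < δ) :
    Tendsto (fun s : ℝ => a ^ s) (𝓝 δ) (𝓝 (a ^ δ)) := by
  lift a to NNReal using ha
  have h1 : Tendsto (fun s : ℝ => (a ^ s : NNReal)) (𝓝 δ) (𝓝 (a ^ δ)) :=
    tendsto_const_nhds.nnrpow tendsto_id (.inr hδ)
  rw [← ENNReal.coe_rpow_of_nonneg _ hδ.le]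
  refine (ENNReal.tendsto_coe.2 h1).congr' ?_
  filter_upwards [eventually_gt_nhds hδ] with s hs
  exact ENNReal.coe_rpow_of_nonneg _ hs.le

/-- A sequence growing more slowly than `(1 + ε) ^ n` has terms that are small compared with its
partial sums. -/
lemma exists_le_mul_sum {a : ℕ → ℝ} {C q ε : ℝ} (ha : ∀ n, 0 ≤ a n) (ha0 : 0 < a 0)
    (hq : 1 ≤ q) (hε : q < 1 + ε) (hC : ∀ n, a n ≤ C * q ^ n) (N : ℕ) :
    ∃ m ≥ N, a m ≤ ε * ∑ n ∈ Finset.range (m + 1), a n := by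
  by_contra! hcon
  set T : ℕ → ℝ := fun m => ∑ n ∈ Finset.range m, a n with hT
  have hTmono : ∀ m, T m ≤ T (m + 1) := fun m => by
    simp only [hT, Finset.sum_range_succ]; linarith [ha m]
  have hε0 : 0 < ε := by linarith
  have hT1 : 0 < T (N + 1) := by
    refine ha0.trans_le (Finset.single_le_sum (f := a) (fun i _ => ha i) (by simp))
  -- If every late term exceeded `ε` times its partial sum, the partial sums would grow by a factor
  -- `1 + ε` at each step, against the bound `C * m * q ^ m` with `q < 1 + ε`.
  have hgrow : ∀ k, (1 + ε) ^ k * T (N + 1) ≤ T (N + 1 + k) := by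
    intro k
    induction k with
    | zero => simp
    | succ k ih =>
      have h1 := hcon (N + 1 + k) (by omega)
      have h2 : T (N + 1 + k + 1) = T (N + 1 + k) + a (N + 1 + k) := Finset.sum_range_succ _ _
      have h3 := mul_le_mul_of_nonneg_left (hTmono (N + 1 + k)) hε0.le
      have h4 : ε * T (N + 1 + k + 1) < a (N + 1 + k) := h1
      rw [pow_succ, ← add_assoc]
      nlinarith
  have hC0 : 0 ≤ C := by simpa using (ha 0).trans (hC 0)
  have hup : ∀ m, T m ≤ C * (m * q ^ m) := by
    intro m
    refine (Finset.sum_le_card_nsmul _ _ (C * q ^ m) fun n hn => (hC n).trans ?_).trans_eq ?_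
    · have := pow_le_pow_right₀ hq (Finset.mem_range.1 hn).le
      gcongr
    · simp; ring
  have hq0 : 0 < q := by linarith
  have hρ : 1 < (1 + ε) / q := (one_lt_div hq0).2 hε
  set ρ := (1 + ε) / q with hρdef
  have hlim : Tendsto (fun k : ℕ => C * q ^ (N + 1) * ((N + 1) * ((k : ℝ) ^ 0 / ρ ^ k) +
      (k : ℝ) ^ 1 / ρ ^ k)) atTop (𝓝 (C * q ^ (N + 1) * ((N + 1) * 0 + 0))) :=
    (((tendsto_pow_const_div_const_pow_of_one_lt 0 hρ).const_mul _).add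
      (tendsto_pow_const_div_const_pow_of_one_lt 1 hρ)).const_mul _
  simp only [mul_zero, add_zero] at hlim
  obtain ⟨k, hk⟩ := (hlim.eventually (gt_mem_nhds hT1)).exists
  refine absurd hk (not_lt.2 ?_)
  have hρk : 0 < ρ ^ k := by positivity
  have hkey : ρ ^ k * T (N + 1) ≤ C * q ^ (N + 1) * (N + 1 + k) := by
    have h1 := (hgrow k).trans (hup (N + 1 + k))
    have h2 : (1 + ε) ^ k = ρ ^ k * q ^ k := by
      rw [hρdef, div_pow, div_mul_cancel₀ _ (by positivity)]
    rw [h2, pow_add q (N + 1) k] at h1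
    have h3 : q ^ k * (ρ ^ k * T (N + 1)) ≤ q ^ k * (C * q ^ (N + 1) * (N + 1 + k)) := by
      push_cast at h1
      linarith
    exact le_of_mul_le_mul_left h3 (by positivity)
  have : C * q ^ (N + 1) * ((N + 1) * ((k : ℝ) ^ 0 / ρ ^ k) + (k : ℝ) ^ 1 / ρ ^ k) =
      C * q ^ (N + 1) * (N + 1 + k) / ρ ^ k := by
    rw [pow_zero, pow_one]; field_simp
  rw [this, le_div_iff₀ hρk]
  linarith

namespace Correspondence

/-- The sum of `|Dγ(x)| ^ t` over the germs `γ` of branches of `F^n` at `x`. -/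
def levelSum (F : Correspondence) (x : Sphere) (n : ℕ) (t : ℝ) : ℝ≥0∞ :=
  ∑' γ : germBranches (F.iter n) x, germDeriv γ.1 ^ t

variable {F : Correspondence}

lemma germSum_one (F : Correspondence) (x : Sphere) (t : ℕ → ℝ) :
    (F.germSum x t fun _ => 1) = ∑' n, F.levelSum x n (t n) := by
  simp [germSum, levelSum]

lemma levelSum_le_add (x : Sphere) (n : ℕ) {s t u : ℝ} (hs : s ≤ t) (hu : t ≤ u) :
    F.levelSum x n t ≤ F.levelSum x n s + F.levelSum x n u := by
  rw [levelSum, levelSum, levelSum, ← ENNReal.tsum_add]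
  exact ENNReal.tsum_le_tsum fun γ => rpow_le_rpow_add_rpow _ hs hu

lemma tsum_levelSum_le_add (x : Sphere) {s t u : ℝ} (hs : s ≤ t) (hu : t ≤ u) :
    ∑' n, F.levelSum x n t ≤ ∑' n, F.levelSum x n s + ∑' n, F.levelSum x n u := by
  rw [← ENNReal.tsum_add]
  exact ENNReal.tsum_le_tsum fun n => levelSum_le_add x n hs hu

lemma IsBranchDomain.levelSum_lt_top {x : Sphere} {U : Set Sphere} (hU : F.IsBranchDomain x U)
    (n : ℕ) {t : ℝ} (ht : 0 ≤ t) : F.levelSum x n t < ∞ := by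
  have := hU.finite_germBranches n
  have := Fintype.ofFinite (germBranches (F.iter n) x)
  rw [levelSum, tsum_fintype]
  exact ENNReal.sum_lt_top.2 fun γ _ => ENNReal.rpow_lt_top_of_nonneg ht (germDeriv_ne_top _)

/-- Hölder's inequality between the exponents `0` and `δ`. -/
lemma IsBranchDomain.levelSum_le {x : Sphere} {U : Set Sphere} (hU : F.IsBranchDomain x U)
    (n : ℕ) {t δ : ℝ} (ht : 0 < t) (htδ : t ≤ δ) :
    F.levelSum x n t ≤ F.levelSum x n δ ^ (t / δ) *
      ENNReal.ofReal (((F.poly.degreeOf 1 + 1 : ℕ) : ℝ) ^ (1 - t / δ)) ^ n := by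
  have := hU.finite_germBranches n
  have := Fintype.ofFinite (germBranches (F.iter n) x)
  have hcard := hU.card_germBranches_le n
  rw [Nat.card_eq_fintype_card] at hcard
  set R : ℕ := F.poly.degreeOf 1 + 1 with hR
  have hδ : 0 < δ := ht.trans_le htδ
  -- Power mean inequality with exponent `δ / t`; raising it to the power `t / δ` leaves the number
  -- of branches with exponent `1 - t / δ`.
  have h1 := ENNReal.rpow_sum_le_const_mul_sum_rpow (s := Finset.univ)
    (f := fun γ : germBranches (F.iter n) x => germDeriv γ.1 ^ t) (p := δ / t)
    ((one_le_div ht).2 htδ)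
  simp only [← ENNReal.rpow_mul, mul_div_cancel₀ δ ht.ne'] at h1
  rw [← tsum_fintype (L := .unconditional _), ← tsum_fintype (L := .unconditional _)] at h1
  change F.levelSum x n t ^ (δ / t) ≤ _ * F.levelSum x n δ at h1
  have h2 := ENNReal.rpow_le_rpow h1 (div_pos ht hδ).le
  rw [← ENNReal.rpow_mul, div_mul_div_cancel₀ ht.ne', div_self hδ.ne', ENNReal.rpow_one,
    ENNReal.mul_rpow_of_nonneg _ _ (div_pos ht hδ).le, ← ENNReal.rpow_mul,
    mul_comm] at h2
  refine h2.trans ?_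
  gcongr
  have h3 : (δ / t - 1) * (t / δ) = 1 - t / δ := by field_simp
  have h4 : 0 ≤ 1 - t / δ := sub_nonneg.2 ((div_le_one hδ).2 htδ)
  rw [h3, ← ENNReal.ofReal_rpow_of_nonneg (by positivity) h4, ENNReal.ofReal_natCast,
    ← ENNReal.rpow_natCast, ← ENNReal.rpow_mul, mul_comm _ (n : ℝ), ENNReal.rpow_mul,
    ENNReal.rpow_natCast]
  refine ENNReal.rpow_le_rpow ?_ h4
  rw [Finset.card_univ]
  exact_mod_cast hcard

/-- The identity contributes `1` at level `0`. -/
lemma one_le_levelSum_zero (F : Correspondence) (x : Sphere) (t : ℝ) :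
    1 ≤ F.levelSum x 0 t := by
  have hid : IsBranchOn (F.iter 0) univ id :=
    ⟨.inl fun p _ => holomorphicNear_id p, fun p _ => by simp [iter]⟩
  refine le_trans ?_ (ENNReal.le_tsum
    ⟨((id : Sphere → Sphere) : Germ (𝓝 x) Sphere), germ_mem_germBranches isOpen_univ trivial hid⟩)
  simp

/-- Fatou's lemma for the Poincaré series. -/
lemma tsum_levelSum_le_of_frequently (x : Sphere) {δ : ℝ} (hδ : 0 < δ) {C : ℝ≥0∞}
    (h : ∃ᶠ s in 𝓝[>] δ, ∑' n, F.levelSum x n s ≤ C) : ∑' n, F.levelSum x n δ ≤ C := by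
  simp only [levelSum, ← ENNReal.tsum_sigma] at h ⊢
  rw [ENNReal.tsum_eq_iSup_sum]
  refine iSup_le fun A => ?_
  have hlim : Tendsto (fun s : ℝ => ∑ i ∈ A, germDeriv i.2.1 ^ s) (𝓝[>] δ)
      (𝓝 (∑ i ∈ A, germDeriv i.2.1 ^ δ)) :=
    (tendsto_finsetSum _ fun i _ =>
      tendsto_const_rpow (germDeriv_ne_top i.2.1) hδ).mono_left nhdsWithin_le_nhds
  exact le_of_tendsto_of_frequently hlim (h.mono fun s hs => (ENNReal.sum_le_tsum A).trans hs)

/-- If the series converges at `δ` and diverges at `t < δ`, then arbitrarily late partial sums of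
the series at `t` are as large as one likes and dominate their last term. -/
lemma IsBranchDomain.exists_last_term_le {x : Sphere} {U : Set Sphere}
    (hU : F.IsBranchDomain x U) {t δ ε : ℝ} (ht : 0 < t) (htδ : t ≤ δ)
    (hfin : ∑' n, F.levelSum x n δ < ∞) (hinf : ∑' n, F.levelSum x n t = ∞)
    (hε : ((F.poly.degreeOf 1 + 1 : ℕ) : ℝ) ^ (1 - t / δ) < 1 + ε) (N : ℕ) (r : ℝ) :
    ∃ m ≥ N, ENNReal.ofReal r ≤ ∑ n ∈ Finset.range (m + 1), F.levelSum x n t ∧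
      F.levelSum x m t ≤ ENNReal.ofReal ε * ∑ n ∈ Finset.range (m + 1), F.levelSum x n t := by
  have hδ : 0 < δ := ht.trans_le htδ
  set q : ℝ := ((F.poly.degreeOf 1 + 1 : ℕ) : ℝ) ^ (1 - t / δ) with hq
  have h4 : 0 ≤ 1 - t / δ := sub_nonneg.2 ((div_le_one hδ).2 htδ)
  have hq1 : 1 ≤ q := Real.one_le_rpow (by simp) h4
  set a : ℕ → ℝ := fun n => (F.levelSum x n t).toReal with ha
  have hL : ∀ n, F.levelSum x n t = ENNReal.ofReal (a n) := fun n =>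
    (ENNReal.ofReal_toReal (hU.levelSum_lt_top n ht.le).ne).symm
  have ha0 : 0 < a 0 := by
    refine ENNReal.toReal_pos ?_ (hU.levelSum_lt_top 0 ht.le).ne
    exact (zero_lt_one.trans_le (F.one_le_levelSum_zero x t)).ne'
  set C : ℝ≥0∞ := (∑' n, F.levelSum x n δ) ^ (t / δ) with hC
  have hCtop : C ≠ ∞ := (ENNReal.rpow_lt_top_of_nonneg (by positivity) hfin.ne).ne
  -- Each level sum at `δ` is at most the whole convergent series, so Hölder's bound is purely
  -- geometric in `n`.
  have hbound : ∀ n, a n ≤ C.toReal * q ^ n := by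
    intro n
    have h1 : F.levelSum x n t ≤ C * ENNReal.ofReal q ^ n := by
      refine (hU.levelSum_le n ht htδ).trans ?_
      gcongr
      exact ENNReal.rpow_le_rpow (ENNReal.le_tsum n) (by positivity)
    have h2 := ENNReal.toReal_mono (ENNReal.mul_ne_top hCtop (by finiteness)) h1
    rwa [ENNReal.toReal_mul, ENNReal.toReal_pow, ENNReal.toReal_ofReal (by linarith)] at h2
  have hsum : ∀ m, ∑ n ∈ Finset.range m, F.levelSum x n t =
      ENNReal.ofReal (∑ n ∈ Finset.range m, a n) := fun m => by
    rw [ENNReal.ofReal_sum_of_nonneg fun n _ => ENNReal.toReal_nonneg]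
    exact Finset.sum_congr rfl fun n _ => hL n
  have htend := ENNReal.tendsto_nat_tsum fun n => F.levelSum x n t
  rw [hinf] at htend
  obtain ⟨N', hN'⟩ := (htend.eventually (lt_mem_nhds (ENNReal.ofReal_lt_top (r := r)))).exists
  obtain ⟨m, hm, hm'⟩ := exists_le_mul_sum (a := a) (fun n => ENNReal.toReal_nonneg) ha0 hq1 hε hbound
    (max N N')
  refine ⟨m, (le_max_left _ _).trans hm, hN'.le.trans ?_, ?_⟩
  · exact Finset.sum_le_sum_of_subset
      (Finset.range_subset_range.2 (((le_max_right _ _).trans hm).trans (Nat.le_succ _)))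
  · rw [hsum, hL, ← ENNReal.ofReal_mul (by linarith)]
    exact ENNReal.ofReal_le_ofReal hm'

/-! ### Families of exponents -/

/-- The part of the weights at levels where the exponent changes. -/
def jumpSum (F : Correspondence) (x : Sphere) (t : ℕ → ℝ) : ℝ≥0∞ :=
  open Classical in ∑' n, if t (n + 1) = t n then 0 else
    F.levelSum x n (t n) + F.levelSum x n (t (n + 1))

/-- The properties of a family of exponents `τ s` (for `s` decreasing to `δ`) that make the limits
of the normalized weighted sums conformal. -/
structure IsAdmissible (F : Correspondence) (x : Sphere) (δ : ℝ) (τ : ℝ → ℕ → ℝ) : Prop where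
  close : ∀ᶠ s in 𝓝[>] δ, ∀ n, |τ s n - δ| ≤ s - δ
  finite : ∀ᶠ s in 𝓝[>] δ, ∑' n, F.levelSum x n (τ s n) < ∞
  diverges : Tendsto (fun s => ∑' n, F.levelSum x n (τ s n)) (𝓝[>] δ) (𝓝 ∞)
  jump : Tendsto (fun s => (∑' n, F.levelSum x n (τ s n))⁻¹ * F.jumpSum x (τ s)) (𝓝[>] δ) (𝓝 0)

lemma isAdmissible_const {x : Sphere} {δ : ℝ}
    (hfin : ∀ᶠ s in 𝓝[>] δ, ∑' n, F.levelSum x n s < ∞)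
    (hdiv : Tendsto (fun s => ∑' n, F.levelSum x n s) (𝓝[>] δ) (𝓝 ∞)) :
    F.IsAdmissible x δ fun s _ => s where
  close := by
    filter_upwards [self_mem_nhdsWithin] with s hs n
    rw [abs_of_pos (sub_pos.2 hs)]
  finite := hfin
  diverges := hdiv
  jump := by simp [jumpSum]

/-- The value `m + 1` makes `m` the last level with the small exponent, so the only possible jump is
from `m` to `m + 1`. -/
lemma modifiedExponent_eq {h : ℝ → ℝ} {δ s : ℝ} {m : ℕ} (hm : h (1 / (s - δ)) = m + 1) (n : ℕ) :
    modifiedExponent h δ s n = if n ≤ m then 2 * δ - s else s := by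
  have : (n : ℝ) < h (1 / (s - δ)) ↔ n ≤ m := by
    rw [hm]
    exact_mod_cast Nat.lt_succ_iff
  simp only [modifiedExponent, this]

/-- The modified exponents are admissible for a suitable choice of `h`. -/
lemma IsBranchDomain.exists_isAdmissible_modifiedExponent {x : Sphere} {U : Set Sphere}
    (hU : F.IsBranchDomain x U) {δ : ℝ} (hδ : 0 < δ)
    (hfin : ∑' n, F.levelSum x n δ < ∞) {C : ℝ≥0∞} (hC : C ≠ ∞)
    (hbdd : ∀ᶠ s in 𝓝[>] δ, ∑' n, F.levelSum x n s ≤ C)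
    (hinf : ∀ t, 0 < t → t < δ → ∑' n, F.levelSum x n t = ∞) (h₀ : ℝ → ℝ) :
    ∃ h : ℝ → ℝ, (∀ r, h₀ r ≤ h r) ∧ F.IsAdmissible x δ (modifiedExponent h δ) := by
  classical
  set R : ℝ := ((F.poly.degreeOf 1 + 1 : ℕ) : ℝ) with hR
  have hR0 : 0 < R := by positivity
  -- The growth rate of the level sums at `2δ - s`, minus `1`; the summand `s - δ` makes the
  -- inequality required by `exists_last_term_le` strict.
  set ε : ℝ → ℝ := fun s => R ^ (1 - (2 * δ - s) / δ) - 1 + (s - δ) with hε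
  have hεlim : Tendsto ε (𝓝[>] δ) (𝓝 0) := by
    have hc : Continuous ε := by
      have h1 : Continuous fun s : ℝ => R ^ (1 - (2 * δ - s) / δ) :=
        continuous_const.rpow (by fun_prop) fun _ => .inl hR0.ne'
      fun_prop
    have h0 : ε δ = 0 := by
      have : 1 - (2 * δ - δ) / δ = 0 := by field_simp; ring
      simp only [hε, this]; simp
    have := hc.tendsto δ
    rw [h0] at this
    exact this.mono_left nhdsWithin_le_nhds
  have hex : ∀ s, ∃ m : ℕ, δ < s → s < 2 * δ → h₀ (1 / (s - δ)) ≤ m ∧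
      ENNReal.ofReal (1 / (s - δ)) ≤
        ∑ n ∈ Finset.range (m + 1), F.levelSum x n (2 * δ - s) ∧
      F.levelSum x m (2 * δ - s) ≤ ENNReal.ofReal (ε s) *
        ∑ n ∈ Finset.range (m + 1), F.levelSum x n (2 * δ - s) := by
    intro s
    by_cases hs : δ < s ∧ s < 2 * δ
    · obtain ⟨m, hm, h1, h2⟩ := hU.exists_last_term_le (t := 2 * δ - s) (δ := δ) (ε := ε s)
        (by linarith) (by linarith) hfin (hinf _ (by linarith) (by linarith))
        (by simp only [hε, hR]; linarith) ⌈h₀ (1 / (s - δ))⌉₊ (1 / (s - δ))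
      exact ⟨m, fun _ _ => ⟨(Nat.le_ceil _).trans (by exact_mod_cast hm), h1, h2⟩⟩
    · exact ⟨0, fun h1 h2 => absurd ⟨h1, h2⟩ hs⟩
  choose m hm using hex
  -- The substitution `r = 1 / (s - δ)` is inverted by `s = δ + 1 / r`, and the condition says `δ <
  -- s < 2δ`.
  set h : ℝ → ℝ := fun r => if 0 < r ∧ 1 / r < δ then (m (δ + 1 / r) : ℝ) + 1 else h₀ r with hh
  have hspec : ∀ᶠ s in 𝓝[>] δ, δ < s ∧ s < 2 * δ ∧ h (1 / (s - δ)) = m s + 1 := by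
    filter_upwards [Ioo_mem_nhdsGT (show δ < 2 * δ by linarith)] with s hs
    have h1 : 0 < s - δ := sub_pos.2 hs.1
    refine ⟨hs.1, hs.2, ?_⟩
    rw [hh]
    simp only [one_div_one_div, one_div_pos, h1, true_and]
    rw [if_pos (by linarith [hs.2])]
    simp
  set Z : ℝ → ℝ≥0∞ := fun s => ∑' n, F.levelSum x n (modifiedExponent h δ s n) with hZ
  have hlow : ∀ᶠ s in 𝓝[>] δ,
      ∑ n ∈ Finset.range (m s + 1), F.levelSum x n (2 * δ - s) ≤ Z s := by
    filter_upwards [hspec] with s hs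
    refine (Finset.sum_congr rfl fun n hn => ?_).trans_le (ENNReal.sum_le_tsum _)
    rw [modifiedExponent_eq hs.2.2, if_pos (Nat.lt_succ_iff.1 (Finset.mem_range.1 hn))]
  have hdiv : Tendsto Z (𝓝[>] δ) (𝓝 ∞) := by
    have h1 : Tendsto (fun s => ENNReal.ofReal (1 / (s - δ))) (𝓝[>] δ) (𝓝 ∞) := by
      refine ENNReal.tendsto_ofReal_atTop.comp ?_
      simp only [one_div]
      refine tendsto_inv_nhdsGT_zero.comp (tendsto_nhdsWithin_iff.2 ⟨?_, ?_⟩)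
      · have : Tendsto (fun s => s - δ) (𝓝 δ) (𝓝 (δ - δ)) := tendsto_id.sub_const δ
        rw [sub_self] at this
        exact this.mono_left nhdsWithin_le_nhds
      · filter_upwards [self_mem_nhdsWithin] with s hs using sub_pos.2 (mem_Ioi.1 hs)
    refine tendsto_nhds_top_mono h1 ?_
    filter_upwards [hspec, hlow] with s hs hs'
    exact (hm s hs.1 hs.2.1).2.1.trans hs'
  refine ⟨h, fun r => ?_, ⟨?_, ?_, hdiv, ?_⟩⟩
  · simp only [hh]
    split_ifs with hr
    · have h1 : 0 < 1 / r := one_div_pos.2 hr.1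
      have := (hm (δ + 1 / r) (by linarith) (by linarith [hr.2])).1
      rw [add_sub_cancel_left, one_div_one_div] at this
      linarith
    · exact le_rfl
  · filter_upwards [hspec] with s hs n
    have h1 := sub_pos.2 hs.1
    rw [modifiedExponent_eq hs.2.2]
    split_ifs
    · rw [show 2 * δ - s - δ = -(s - δ) by ring, abs_neg, abs_of_pos h1]
    · rw [abs_of_pos h1]
  · filter_upwards [hspec, hbdd] with s hs hb
    have hle : ∀ n, F.levelSum x n (modifiedExponent h δ s n) ≤
        (if n ∈ Finset.range (m s + 1) then F.levelSum x n (2 * δ - s) else 0) +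
          F.levelSum x n s := by
      intro n
      rw [modifiedExponent_eq hs.2.2]
      by_cases hn : n ≤ m s
      · rw [if_pos hn, if_pos (Finset.mem_range.2 (Nat.lt_succ_of_le hn))]
        exact le_self_add
      · rw [if_neg hn]
        exact le_add_self
    refine (ENNReal.tsum_le_tsum hle).trans_lt ?_
    rw [ENNReal.tsum_add, tsum_eq_sum (s := Finset.range (m s + 1)) fun n hn => if_neg hn]
    refine ENNReal.add_lt_top.2 ⟨ENNReal.sum_lt_top.2 fun n hn => ?_, hb.trans_lt hC.lt_top⟩
    rw [if_pos hn]
    exact hU.levelSum_lt_top n (by linarith [hs.2.1])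
  · have hjump : ∀ᶠ s in 𝓝[>] δ, (Z s)⁻¹ * F.jumpSum x (modifiedExponent h δ s) ≤
        ENNReal.ofReal (ε s) + (Z s)⁻¹ * C := by
      filter_upwards [hspec, hlow, hbdd] with s hs hl hb
      have hτ := modifiedExponent_eq hs.2.2
      -- Only level `m s` can contribute. Its sum at `2δ - s` is at most `ε s` times the total by
      -- the choice of `m`, and its sum at `s` is at most `C`.
      have h1 : F.jumpSum x (modifiedExponent h δ s) ≤
          F.levelSum x (m s) (2 * δ - s) + F.levelSum x (m s) s := by
        rw [jumpSum, tsum_eq_single (m s) fun n hn => ?_]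
        · rw [hτ, hτ, if_neg (Nat.not_succ_le_self _), if_pos le_rfl]
          split_ifs
          · exact zero_le
          · exact le_rfl
        · rw [hτ, hτ, if_pos]
          rcases lt_or_gt_of_ne hn with h | h
          · rw [if_pos (Nat.succ_le_of_lt h), if_pos h.le]
          · rw [if_neg (by omega), if_neg (by omega)]
      calc (Z s)⁻¹ * F.jumpSum x (modifiedExponent h δ s)
          ≤ (Z s)⁻¹ * (ENNReal.ofReal (ε s) * Z s + C) := by
            gcongr
            refine h1.trans (add_le_add ((hm s hs.1 hs.2.1).2.2.trans ?_)
              ((ENNReal.le_tsum (m s)).trans hb))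
            gcongr
        _ = ENNReal.ofReal (ε s) * ((Z s)⁻¹ * Z s) + (Z s)⁻¹ * C := by ring
        _ ≤ ENNReal.ofReal (ε s) * 1 + (Z s)⁻¹ * C := by
            gcongr
            exact ENNReal.inv_mul_le_one _
        _ = _ := by rw [mul_one]
    refine tendsto_of_tendsto_of_tendsto_of_le_of_le' tendsto_const_nhds ?_
      (Eventually.of_forall fun _ => zero_le) hjump
    have h2 : Tendsto (fun s => ENNReal.ofReal (ε s)) (𝓝[>] δ) (𝓝 0) := by
      simpa using ENNReal.tendsto_ofReal hεlim
    have h3 : Tendsto (fun s => (Z s)⁻¹ * C) (𝓝[>] δ) (𝓝 0) := by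
      have := ENNReal.Tendsto.mul_const (b := C)
        (tendsto_inv_iff.2 hdiv) (.inr hC)
      simpa using this
    simpa using h2.add h3

end Correspondence

/-! ### Weak* limits: support and transport of integrals -/

/-- Uniform continuity of `(a, u) ↦ a ^ u` on a compact rectangle with positive exponents, where `a
= 0` is harmless. It lets the exponent of `|Df|` be replaced by `δ` at all levels at once. -/
lemma exists_forall_abs_rpow_sub_le {δ : ℝ} (hδ : 0 < δ) (K : ℝ) {e : ℝ} (he : 0 < e) :
    ∃ η > 0, ∀ u, |u - δ| ≤ η → 0 < u ∧ ∀ a, 0 ≤ a → a ≤ K → |a ^ u - a ^ δ| ≤ e := by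
  have hcomp : IsCompact (Icc 0 K ×ˢ Icc (δ / 2) (2 * δ)) := isCompact_Icc.prod isCompact_Icc
  have hcont : ContinuousOn (fun p : ℝ × ℝ => p.1 ^ p.2) (Icc 0 K ×ˢ Icc (δ / 2) (2 * δ)) :=
    fun p hp => (Real.continuousAt_rpow_of_pos p
      (by linarith [hp.2.1])).continuousWithinAt
  obtain ⟨η, hη, h⟩ := Metric.uniformContinuousOn_iff_le.1
    (hcomp.uniformContinuousOn_of_continuous hcont) e he
  refine ⟨min η (δ / 2), by positivity, fun u hu => ?_⟩
  have h1 := abs_le.1 (hu.trans (min_le_right _ _))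
  refine ⟨by linarith, fun a ha haK => ?_⟩
  have := h (a, u) ⟨⟨ha, haK⟩, by constructor <;> linarith⟩ (a, δ)
    ⟨⟨ha, haK⟩, by constructor <;> linarith⟩
    (by rw [Prod.dist_eq, dist_self, Real.dist_eq]; exact max_le hη.le (hu.trans (min_le_left _ _)))
  rwa [Real.dist_eq] at this

lemma lintegral_ofReal_continuousMap {μ : Measure Sphere} [IsFiniteMeasure μ] {φ : C(Sphere, ℝ)}
    (hφ : ∀ z, 0 ≤ φ z) :
    ∫⁻ z, ENNReal.ofReal (φ z) ∂μ = ENNReal.ofReal (∫ z, φ z ∂μ) := by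
  rw [ofReal_integral_eq_lintegral_ofReal
    (φ.continuous.integrable_of_hasCompactSupport (HasCompactSupport.of_compactSpace _))
    (Eventually.of_forall hφ)]

namespace Correspondence

/-- The sum of `|Dγ(x)| ^ t * φ(γ(x))` over the germs `γ` of branches of `F^n` at `x`. -/
def levelInt (F : Correspondence) (x : Sphere) (n : ℕ) (t : ℝ) (φ : Sphere → ℝ≥0∞) : ℝ≥0∞ :=
  ∑' γ : germBranches (F.iter n) x, germDeriv γ.1 ^ t * φ γ.1.value

variable {F : Correspondence}

lemma levelInt_mono {x : Sphere} {n : ℕ} (t : ℝ) {φ ψ : Sphere → ℝ≥0∞}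
    (h : ∀ y ∈ F.iter n x, φ y ≤ ψ y) : F.levelInt x n t φ ≤ F.levelInt x n t ψ :=
  ENNReal.tsum_le_tsum fun γ => by gcongr; exact h _ (value_mem γ.2)

lemma levelInt_add_const (x : Sphere) (n : ℕ) (t : ℝ) (φ : Sphere → ℝ≥0∞) (c : ℝ≥0∞) :
    F.levelInt x n t (fun y => φ y + c) = F.levelInt x n t φ + c * F.levelSum x n t := by
  rw [levelInt, levelInt, levelSum, ← ENNReal.tsum_mul_left, ← ENNReal.tsum_add]
  exact tsum_congr fun γ => by ring

lemma levelInt_le {x : Sphere} {n : ℕ} (t : ℝ) {φ : Sphere → ℝ≥0∞} {c : ℝ≥0∞}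
    (h : ∀ y ∈ F.iter n x, φ y ≤ c) : F.levelInt x n t φ ≤ c * F.levelSum x n t := by
  refine (levelInt_mono t h).trans_eq ?_
  rw [levelInt, levelSum, ENNReal.tsum_mul_right, mul_comm]

/-- Replacing `t(n)` by `t(n+1)` at level `n` costs at most a multiple of the jump sum. -/
lemma tsum_levelInt_shift {x : Sphere} {S : Set Sphere} (hS : ∀ n, F.iter n x ⊆ S) (t : ℕ → ℝ)
    {φ : Sphere → ℝ≥0∞} {c : ℝ≥0∞} (h : ∀ y ∈ S, φ y ≤ c) :
    ∑' n, F.levelInt x n (t (n + 1)) φ ≤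
        ∑' n, F.levelInt x n (t n) φ + c * F.jumpSum x t ∧
      ∑' n, F.levelInt x n (t n) φ ≤
        ∑' n, F.levelInt x n (t (n + 1)) φ + c * F.jumpSum x t := by
  rw [jumpSum, ← ENNReal.tsum_mul_left, ← ENNReal.tsum_add, ← ENNReal.tsum_add]
  constructor <;> refine ENNReal.tsum_le_tsum fun n => ?_ <;> split_ifs with ht
  · rw [ht]; exact le_self_add
  · refine le_add_left ((levelInt_le _ fun y hy => h y (hS n hy)).trans ?_)
    gcongr
    exact le_add_self
  · rw [ht]; exact le_self_add
  · refine le_add_left ((levelInt_le _ fun y hy => h y (hS n hy)).trans ?_)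
    gcongr
    exact le_self_add

lemma germSum_eq_tsum_levelInt (x : Sphere) (t : ℕ → ℝ) (φ : Sphere → ℝ≥0∞) :
    F.germSum x t φ = ∑' n, F.levelInt x n (t n) φ := rfl

section WeakLimit

variable {x : Sphere} {U : Set Sphere} {δ : ℝ} {τ : ℝ → ℕ → ℝ}

lemma one_le_tsum_levelSum (F : Correspondence) (x : Sphere) (t : ℕ → ℝ) :
    1 ≤ ∑' n, F.levelSum x n (t n) :=
  (F.one_le_levelSum_zero x (t 0)).trans (ENNReal.le_tsum 0)

lemma IsAdmissible.isProbabilityMeasure (hτ : F.IsAdmissible x δ τ) (hU : F.IsBranchDomain x U) :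
    ∀ᶠ s in 𝓝[>] δ, IsProbabilityMeasure (F.psMeasure x U (τ s)) := by
  filter_upwards [hτ.finite] with s hs
  refine ⟨?_⟩
  have h := hU.lintegral_psMeasure (τ s) fun _ => 1
  rw [lintegral_one] at h
  rw [h, germSum_one]
  exact ENNReal.inv_mul_cancel (zero_lt_one.trans_le (one_le_tsum_levelSum F x _)).ne' hs.ne

lemma IsAdmissible.tendsto_germSum (hτ : F.IsAdmissible x δ τ) (hU : F.IsBranchDomain x U)
    {l : Filter ℝ} (hl : l ≤ 𝓝[>] δ) {μ : Measure Sphere} [IsFiniteMeasure μ] {φ : C(Sphere, ℝ)}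
    (hφ : ∀ z, 0 ≤ φ z)
    (h : Tendsto (fun s => ∫ z, φ z ∂(F.psMeasure x U (τ s))) l (𝓝 (∫ z, φ z ∂μ))) :
    Tendsto (fun s => (∑' n, F.levelSum x n (τ s n))⁻¹ *
      ∑' n, F.levelInt x n (τ s n) fun z => ENNReal.ofReal (φ z)) l
      (𝓝 (∫⁻ z, ENNReal.ofReal (φ z) ∂μ)) := by
  rw [lintegral_ofReal_continuousMap hφ]
  refine (ENNReal.tendsto_ofReal h).congr' ?_
  filter_upwards [hl (hτ.isProbabilityMeasure hU)] with s hs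
  have := hs
  rw [← lintegral_ofReal_continuousMap hφ, hU.lintegral_psMeasure, germSum_one,
    germSum_eq_tsum_levelInt]

/-- The total mass diverges, so bounded quantities, in particular any finite set of levels,
disappear after normalization. -/
lemma IsAdmissible.tendsto_inv_mul (hτ : F.IsAdmissible x δ τ) {c : ℝ → ℝ≥0∞} {C : ℝ≥0∞}
    (hC : C ≠ ∞) (hc : ∀ᶠ s in 𝓝[>] δ, c s ≤ C) :
    Tendsto (fun s => (∑' n, F.levelSum x n (τ s n))⁻¹ * c s) (𝓝[>] δ) (𝓝 0) := by
  have h1 := ENNReal.Tendsto.mul_const (b := C) (tendsto_inv_iff.2 hτ.diverges) (.inr hC)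
  rw [ENNReal.inv_top, zero_mul] at h1
  refine tendsto_of_tendsto_of_tendsto_of_le_of_le' tendsto_const_nhds h1
    (Eventually.of_forall fun _ => zero_le) ?_
  filter_upwards [hc] with s hs
  gcongr

lemma IsAdmissible.eventually_close (hτ : F.IsAdmissible x δ τ) {η : ℝ} (hη : 0 < η) :
    ∀ᶠ s in 𝓝[>] δ, ∀ n, |τ s n - δ| ≤ η := by
  filter_upwards [hτ.close, Ioo_mem_nhdsGT (show δ < δ + η by linarith)] with s hs hs' n
  linarith [hs n, hs'.2]

lemma IsAdmissible.eventually_levelSum_le (hτ : F.IsAdmissible x δ τ) (hδ : 0 < δ) :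
    ∀ᶠ s in 𝓝[>] δ, ∀ n, F.levelSum x n (τ s n) ≤
      F.levelSum x n (δ / 2) + F.levelSum x n (2 * δ) := by
  filter_upwards [hτ.eventually_close (half_pos hδ)] with s hs n
  have := abs_le.1 (hs n)
  exact levelSum_le_add x n (by linarith) (by linarith)

/-- Weak* limits are supported in the limit set. -/
lemma IsAdmissible.support_subset (hτ : F.IsAdmissible x δ τ) (hδ : 0 < δ)
    (hU : F.IsBranchDomain x U) {μ : Measure Sphere} [IsFiniteMeasure μ]
    (hμ : IsWeakStarLimit (fun s => F.psMeasure x U (τ s)) δ μ) :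
    μ.support ⊆ F.limitSet x := by
  obtain ⟨l, hne, hl, hlim⟩ := hμ
  intro y hy
  by_contra hyΛ
  obtain ⟨n, hn⟩ : ∃ n : ℕ, y ∉ closure (⋃ k ≥ n, F.iter k x) := by
    simpa [limitSet] using hyΛ
  -- A bump at `y` vanishing on all levels from `n` on: only the levels below `n` contribute to its
  -- integrals, and these are bounded.
  obtain ⟨φ, hφ0, hφ1, hφ⟩ := exists_continuous_zero_one_of_isClosed isClosed_closure
    (isClosed_singleton (x := y)) (disjoint_singleton_right.2 hn)
  have h1 := hτ.tendsto_germSum hU hl (fun z => (hφ z).1) (hlim φ)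
  have h2 : Tendsto (fun s => (∑' n, F.levelSum x n (τ s n))⁻¹ *
      ∑' n, F.levelInt x n (τ s n) fun z => ENNReal.ofReal (φ z)) l (𝓝 0) := by
    refine (hτ.tendsto_inv_mul (C := ∑ k ∈ Finset.range n,
      (F.levelSum x k (δ / 2) + F.levelSum x k (2 * δ))) ?_ ?_).mono_left hl
    · exact (ENNReal.sum_lt_top.2 fun k _ => ENNReal.add_lt_top.2
        ⟨hU.levelSum_lt_top k (by linarith), hU.levelSum_lt_top k (by linarith)⟩).ne
    · filter_upwards [hτ.eventually_levelSum_le hδ] with s hs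
      rw [tsum_eq_sum (s := Finset.range n) fun k hk => ?_]
      · refine Finset.sum_le_sum fun k _ => ?_
        refine (levelInt_le (c := 1) _ fun y _ => ?_).trans ((one_mul _).trans_le (hs k))
        exact ENNReal.ofReal_le_one.2 (hφ y).2
      · refine le_antisymm ((levelInt_le (c := 0) _ fun y hy => ?_).trans_eq (zero_mul _)) zero_le
        have hy' : y ∈ closure (⋃ k ≥ n, F.iter k x) :=
          subset_closure (mem_iUnion₂.2 ⟨k, by simpa using hk, hy⟩)
        simp [hφ0 hy']
  have h3 := tendsto_nhds_unique h1 h2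
  rw [lintegral_eq_zero_iff (by fun_prop)] at h3
  refine (Measure.notMem_support_iff_exists.2
    ⟨{z | ENNReal.ofReal (φ z) ≠ 0}, ?_, measure_eq_zero_iff_ae_notMem.2 ?_⟩) hy
  · have hop : IsOpen {z | ENNReal.ofReal (φ z) ≠ 0} :=
      isOpen_ne.preimage (f := fun z => ENNReal.ofReal (φ z))
      (ENNReal.continuous_ofReal.comp φ.continuous)
    refine hop.mem_nhds ?_
    have : φ y = 1 := hφ1 rfl
    simp [this]
  · filter_upwards [h3] with z hz
    simpa using hz

/-- Transport of the integral of a weak* limit by a branch. -/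
lemma IsAdmissible.lintegral_eq (hτ : F.IsAdmissible x δ τ) (hδ : 0 < δ)
    (hU : F.IsBranchDomain x U) {S : Set Sphere} (hF : F.InvariantlyInverseLike S) (hx : x ∈ S)
    {V W N : Set Sphere} (hV : IsOpen V)
    {f : Sphere → Sphere} (hf : IsBranchOn F.image V f) (hW : IsOpen W) (hN : IsOpen N)
    (hWV : W ⊆ V) (h1 : ∀ y ∈ S, ∀ w ∈ F.image y, w ∈ N → y ∈ W)
    (h2 : ∀ y ∈ W, ∀ w ∈ F.image y, w ∈ N → w = f y) {K : ℝ}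
    (hK : ∀ y ∈ W, sphDeriv f y ≤ K) {μ : Measure Sphere} [IsFiniteMeasure μ]
    (hμ : IsWeakStarLimit (fun s => F.psMeasure x U (τ s)) δ μ) {φ ψ : C(Sphere, ℝ)}
    (hφ : ∀ z, 0 ≤ φ z) (hψ : ∀ z, 0 ≤ ψ z) (hφN : ∀ w ∉ N, φ w = 0)
    (hψW : ∀ y ∈ W, ψ y = sphDeriv f y ^ δ * φ (f y)) (hψS : ∀ y ∈ S \ W, ψ y = 0) :
    ∫⁻ z, ENNReal.ofReal (φ z) ∂μ = ∫⁻ z, ENNReal.ofReal (ψ z) ∂μ := by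
  classical
  obtain ⟨l, hne, hl, hlim⟩ := hμ
  set Φ : Sphere → ℝ≥0∞ := fun z => ENNReal.ofReal (φ z) with hΦ
  set Ψ : Sphere → ℝ≥0∞ := fun z => ENNReal.ofReal (ψ z) with hΨ
  set Z : ℝ → ℝ≥0∞ := fun s => ∑' n, F.levelSum x n (τ s n) with hZ
  have hA := hτ.tendsto_germSum hU hl hφ (hlim φ)
  have hB := hτ.tendsto_germSum hU hl hψ (hlim ψ)
  have hiter : ∀ n, F.iter n x ⊆ S := hF.iter_subset hx
  obtain ⟨M, hM⟩ : ∃ M : ℝ, ∀ z, φ z ≤ M :=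
    ⟨‖φ‖, fun z => (le_abs_self _).trans (φ.norm_coe_le_norm z)⟩
  obtain ⟨M', hM'⟩ : ∃ M : ℝ, ∀ z, ψ z ≤ M :=
    ⟨‖ψ‖, fun z => (le_abs_self _).trans (ψ.norm_coe_le_norm z)⟩
  have hM0 : 0 ≤ M := (hφ OnePoint.infty).trans (hM _)
  have hJ : Tendsto (fun s => (Z s)⁻¹ * F.jumpSum x (τ s)) l (𝓝 0) := hτ.jump.mono_left hl
  -- the test function transported by `f`, at exponent `u`
  set Θ : ℝ → Sphere → ℝ≥0∞ := fun u y =>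
    if y ∈ W then ENNReal.ofReal (sphDeriv f y) ^ u * Φ (f y) else 0 with hΘ
  have hsucc : ∀ n u, 0 < u → F.levelInt x (n + 1) u Φ = F.levelInt x n u (Θ u) := by
    intro n u hu
    refine hU.tsum_germBranches_succ hF hx hV hf hW hN hWV h1 h2 hu (fun w hw => ?_)
      (fun y hy => ?_) (fun y hy => ?_) n
    · simp [hΦ, hφN w hw]
    · simp [hΘ, hy]
    · simp [hΘ, hy.2]
  -- Besides `ε`, which pays for the exponent of `|Df|`, the errors are the level `0` term, which is
  -- not a transport, and the jump sum, which pays for weighting level `n` with the exponent of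
  -- level `n + 1`.
  have key : ∀ ε : NNReal, 0 < ε → ∀ᶠ s in l,
      (Z s)⁻¹ * ∑' n, F.levelInt x n (τ s n) Φ ≤
        (Z s)⁻¹ * (ENNReal.ofReal M * F.levelSum x 0 (τ s 0)) +
          ((Z s)⁻¹ * ∑' n, F.levelInt x n (τ s n) Ψ + ε +
            (ENNReal.ofReal M' + ε) * ((Z s)⁻¹ * F.jumpSum x (τ s))) ∧
      (Z s)⁻¹ * ∑' n, F.levelInt x n (τ s n) Ψ ≤
        (Z s)⁻¹ * ∑' n, F.levelInt x n (τ s n) Φ + ε +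
            (ENNReal.ofReal M' + ε) * ((Z s)⁻¹ * F.jumpSum x (τ s)) := by
    intro ε hε
    -- The error in the power of `|Df|` gets multiplied by a value of `φ`, at most `M`; the `+ 1`
    -- avoids division by zero.
    obtain ⟨η, hη, hη'⟩ := exists_forall_abs_rpow_sub_le hδ K
      (e := ε / (M + 1)) (by positivity)
    filter_upwards [hl (hτ.eventually_close hη)] with s hs
    have hpos : ∀ n, 0 < τ s n := fun n => (hη' _ (hs n)).1
    have hsplit : ∑' n, F.levelInt x n (τ s n) Φ = F.levelInt x 0 (τ s 0) Φ +
        ∑' n, F.levelInt x n (τ s (n + 1)) (Θ (τ s (n + 1))) := by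
      rw [tsum_eq_zero_add' ENNReal.summable]
      congr 1
      exact tsum_congr fun n => hsucc n _ (hpos _)
    have hcmp : ∀ n, ∀ y ∈ S, Θ (τ s n) y ≤ Ψ y + ε ∧ Ψ y ≤ Θ (τ s n) y + ε := by
      intro n y hy
      by_cases hyW : y ∈ W
      · have h3 := (hη' _ (hs n)).2 _ (sphDeriv_nonneg f y) (hK y hyW)
        have h4 : |sphDeriv f y ^ τ s n * φ (f y) - ψ y| ≤ ε := by
          rw [hψW y hyW, ← sub_mul, abs_mul, abs_of_nonneg (hφ _)]
          calc _ ≤ ε / (M + 1) * M := by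
                have := hM (f y)
                have := hφ (f y)
                gcongr
            _ ≤ ε := by
                rw [div_mul_eq_mul_div, div_le_iff₀ (by positivity)]
                have : (0 : ℝ) ≤ ε := ε.2
                nlinarith
        have h5 : Θ (τ s n) y = ENNReal.ofReal (sphDeriv f y ^ τ s n * φ (f y)) := by
          have : 0 ≤ sphDeriv f y ^ τ s n := Real.rpow_nonneg (sphDeriv_nonneg _ _) _
          simp only [hΘ, hyW, if_true, hΦ]
          rw [ENNReal.ofReal_mul this,
            ENNReal.ofReal_rpow_of_nonneg (sphDeriv_nonneg _ _) (hpos n).le]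
        have hε' : (ε : ℝ≥0∞) = ENNReal.ofReal ε := (ENNReal.ofReal_coe_nnreal).symm
        have h6 := abs_le.1 h4
        rw [h5, hε']
        simp only [hΨ]
        refine ⟨(ENNReal.ofReal_le_ofReal ?_).trans ENNReal.ofReal_add_le,
          (ENNReal.ofReal_le_ofReal ?_).trans ENNReal.ofReal_add_le⟩ <;> linarith
      · simp [hΘ, hyW, hΨ, hψS y ⟨hy, hyW⟩]
    have hΨM : ∀ y ∈ S, Ψ y ≤ ENNReal.ofReal M' := fun y _ => ENNReal.ofReal_le_ofReal (hM' y)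
    have hZZ : (Z s)⁻¹ * Z s ≤ 1 := ENNReal.inv_mul_le_one _
    constructor
    · have h3 : ∑' n, F.levelInt x n (τ s (n + 1)) (Θ (τ s (n + 1))) ≤
          ∑' n, F.levelInt x n (τ s n) Ψ + ε * Z s +
            (ENNReal.ofReal M' + ε) * F.jumpSum x (τ s) := by
        refine (ENNReal.tsum_le_tsum fun n => levelInt_mono _ fun y hy =>
          (hcmp (n + 1) y (hiter n hy)).1).trans ?_
        refine (tsum_levelInt_shift hiter (τ s) (φ := fun y => Ψ y + ε)
          (c := ENNReal.ofReal M' + ε) fun y hy => by gcongr; exact hΨM y hy).1.trans ?_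
        simp only [levelInt_add_const, ENNReal.tsum_add, ENNReal.tsum_mul_left]
        exact le_rfl
      rw [hsplit]
      have h4 : F.levelInt x 0 (τ s 0) Φ ≤ ENNReal.ofReal M * F.levelSum x 0 (τ s 0) :=
        levelInt_le _ fun y _ => ENNReal.ofReal_le_ofReal (hM y)
      calc _ ≤ (Z s)⁻¹ * (ENNReal.ofReal M * F.levelSum x 0 (τ s 0) +
            (∑' n, F.levelInt x n (τ s n) Ψ + ε * Z s +
            (ENNReal.ofReal M' + ε) * F.jumpSum x (τ s))) := by gcongr
        _ = (Z s)⁻¹ * (ENNReal.ofReal M * F.levelSum x 0 (τ s 0)) +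
          ((Z s)⁻¹ * ∑' n, F.levelInt x n (τ s n) Ψ + ε * ((Z s)⁻¹ * Z s) +
            (ENNReal.ofReal M' + ε) * ((Z s)⁻¹ * F.jumpSum x (τ s))) := by ring
        _ ≤ _ := by
          gcongr
          exact (mul_le_mul_right hZZ _).trans_eq (mul_one _)
    · have h3 : ∑' n, F.levelInt x n (τ s n) Ψ ≤
          ∑' n, F.levelInt x n (τ s (n + 1)) (Θ (τ s (n + 1))) +
            ε * (Z s + F.jumpSum x (τ s)) + ENNReal.ofReal M' * F.jumpSum x (τ s) := by
        refine (tsum_levelInt_shift hiter (τ s) hΨM).2.trans ?_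
        gcongr
        refine (ENNReal.tsum_le_tsum fun n => levelInt_mono _ fun y hy =>
          (hcmp (n + 1) y (hiter n hy)).2).trans ?_
        simp only [levelInt_add_const, ENNReal.tsum_add, ENNReal.tsum_mul_left]
        gcongr
        -- The error `ε` is summed against the shifted weights, whose total exceeds `Z s` by at most
        -- the jump sum.
        have h5 := (tsum_levelInt_shift hiter (τ s) (φ := fun _ => 1) (c := 1)
          fun y _ => le_rfl).1
        simpa [levelInt, levelSum, hZ] using h5
      calc _ ≤ (Z s)⁻¹ * (∑' n, F.levelInt x n (τ s (n + 1)) (Θ (τ s (n + 1))) +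
            ε * (Z s + F.jumpSum x (τ s)) + ENNReal.ofReal M' * F.jumpSum x (τ s)) := by gcongr
        _ = (Z s)⁻¹ * (∑' n, F.levelInt x n (τ s (n + 1)) (Θ (τ s (n + 1)))) +
            ε * ((Z s)⁻¹ * Z s) + (ENNReal.ofReal M' + ε) * ((Z s)⁻¹ * F.jumpSum x (τ s)) := by
          ring
        _ ≤ _ := by
          refine add_le_add (add_le_add (mul_le_mul_right ?_ _)
            ((mul_le_mul_right hZZ _).trans_eq (mul_one _))) le_rfl
          rw [hsplit]
          exact le_add_self
  have hL0 : Tendsto (fun s => (Z s)⁻¹ * (ENNReal.ofReal M * F.levelSum x 0 (τ s 0))) l (𝓝 0) := by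
    refine (hτ.tendsto_inv_mul (C := ENNReal.ofReal M *
      (F.levelSum x 0 (δ / 2) + F.levelSum x 0 (2 * δ))) ?_ ?_).mono_left hl
    · exact ENNReal.mul_ne_top ENNReal.ofReal_ne_top (ENNReal.add_lt_top.2
        ⟨hU.levelSum_lt_top 0 (by linarith), hU.levelSum_lt_top 0 (by linarith)⟩).ne
    · filter_upwards [hτ.eventually_levelSum_le hδ] with s hs
      gcongr
      exact hs 0
  have herr : ∀ ε : NNReal, Tendsto (fun s => (ENNReal.ofReal M' + ε) *
      ((Z s)⁻¹ * F.jumpSum x (τ s))) l (𝓝 0) := fun ε => by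
    have := ENNReal.Tendsto.const_mul (a := ENNReal.ofReal M' + ε) hJ
      (.inr (ENNReal.add_ne_top.2 ⟨ENNReal.ofReal_ne_top, ENNReal.coe_ne_top⟩))
    rwa [mul_zero] at this
  refine le_antisymm ?_ ?_
  · refine ENNReal.le_of_forall_pos_le_add fun ε hε _ => ?_
    have hlimR := hL0.add ((hB.add_const (ε : ℝ≥0∞)).add (herr ε))
    rw [zero_add, add_zero] at hlimR
    exact le_of_tendsto_of_tendsto hA hlimR ((key ε hε).mono fun s hs => hs.1)
  · refine ENNReal.le_of_forall_pos_le_add fun ε hε _ => ?_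
    have hlimR := (hA.add_const (ε : ℝ≥0∞)).add (herr ε)
    rw [add_zero] at hlimR
    exact le_of_tendsto_of_tendsto hB hlimR ((key ε hε).mono fun s hs => hs.2)

end WeakLimit

end Correspondence

/-! ### From transported integrals to conformality -/

/-- Two measures with the same integrals of nonnegative continuous functions vanishing off an open
set agree near each point of that set. -/
lemma exists_nhds_measure_eq {μ ν : Measure Sphere} [IsFiniteMeasure μ] {N : Set Sphere}
    (hN : IsOpen N) {b : Sphere} (hb : b ∈ N)
    (h : ∀ φ : C(Sphere, ℝ), (∀ z, 0 ≤ φ z) → (∀ z ∉ N, φ z = 0) →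
      ∫⁻ z, ENNReal.ofReal (φ z) ∂μ = ∫⁻ z, ENNReal.ofReal (φ z) ∂ν) :
    ∃ O, IsOpen O ∧ b ∈ O ∧ ∀ B ⊆ O, MeasurableSet B → μ B = ν B := by
  obtain ⟨C, hC, hCc, hCN⟩ := exists_mem_nhds_isClosed_subset (hN.mem_nhds hb)
  -- Multiplication by the cut-off `κ` turns arbitrary continuous test functions into admissible
  -- ones and changes nothing on `C`.
  obtain ⟨κ, hκ0, hκ1, hκ⟩ := exists_continuous_zero_one_of_isClosed hN.isClosed_compl hCc
    (disjoint_compl_left_iff_subset.2 hCN)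
  have hmeas : Measurable fun z => ENNReal.ofReal (κ z) :=
    κ.continuous.measurable.ennreal_ofReal
  have hfin : IsFiniteMeasure (μ.withDensity fun z => ENNReal.ofReal (κ z)) := by
    refine isFiniteMeasure_withDensity (lt_of_le_of_lt (lintegral_mono (g := fun _ => 1)
      fun z => ENNReal.ofReal_le_one.2 (hκ z).2) ?_).ne
    simp
  have heq : μ.withDensity (fun z => ENNReal.ofReal (κ z)) =
      ν.withDensity fun z => ENNReal.ofReal (κ z) := by
    refine ext_of_forall_lintegral_eq_of_IsFiniteMeasure fun g => ?_
    have hg : Measurable fun z => (g z : ℝ≥0∞) := g.continuous.measurable.coe_nnreal_ennreal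
    rw [lintegral_withDensity_eq_lintegral_mul _ hmeas hg,
      lintegral_withDensity_eq_lintegral_mul _ hmeas hg]
    have hφ := h ⟨fun z => κ z * (g z : ℝ), by fun_prop⟩
      (fun z => mul_nonneg (hκ z).1 (g z).2) (fun z hz => by simp [hκ0 (show z ∈ Nᶜ from hz)])
    simpa [ENNReal.ofReal_mul (hκ _).1] using hφ
  refine ⟨interior C, isOpen_interior, mem_interior_iff_mem_nhds.2 hC, fun B hB hBm => ?_⟩
  have hone : ∀ ρ : Measure Sphere, (ρ.withDensity fun z => ENNReal.ofReal (κ z)) B = ρ B := by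
    intro ρ
    rw [withDensity_apply _ hBm, setLIntegral_congr_fun hBm (g := fun _ => 1) fun z hz => ?_]
    · simp
    · have : κ z = 1 := hκ1 (interior_subset (hB hz))
      simp [this]
  rw [← hone μ, heq, hone ν]

namespace Correspondence

variable {F : Correspondence} {x : Sphere} {U : Set Sphere} {δ : ℝ} {τ : ℝ → ℕ → ℝ}

/-- `|Df| ^ δ` on the domain `V` of the branch `f`, and `0` elsewhere. -/
def branchDensity (f : Sphere → Sphere) (V : Set Sphere) (δ : ℝ) : Sphere → ℝ≥0∞ :=
  open Classical in V.piecewise (fun y => ENNReal.ofReal (sphDeriv f y) ^ δ) fun _ => 0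

/-- The branch `f` on its domain `V`, with the value infinity elsewhere. -/
def branchExtend (f : Sphere → Sphere) (V : Set Sphere) : Sphere → Sphere :=
  open Classical in V.piecewise f fun _ => OnePoint.infty

lemma measurable_branchDensity {V : Set Sphere} (hV : IsOpen V) {f : Sphere → Sphere}
    (hf : IsBranchOn F.image V f) (δ : ℝ) : Measurable (branchDensity f V δ) := by
  classical
  refine ContinuousOn.measurable_piecewise (fun y hy => ?_) continuousOn_const hV.measurableSet
  refine ContinuousAt.continuousWithinAt ?_
  refine ENNReal.continuous_rpow_const.continuousAt.comp
    (ENNReal.continuous_ofReal.continuousAt.comp (continuousAt_sphDeriv ?_))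
  filter_upwards [hV.mem_nhds hy] with z hz using hf.conformalNear hz

lemma measurable_branchExtend {V : Set Sphere} (hV : IsOpen V) {f : Sphere → Sphere}
    (hf : IsBranchOn F.image V f) : Measurable (branchExtend f V) := by
  classical
  exact ContinuousOn.measurable_piecewise
    (fun y hy => (hf.conformalNear hy).continuousAt.continuousWithinAt) continuousOn_const
    hV.measurableSet

lemma branchDensity_of_mem {f : Sphere → Sphere} {V : Set Sphere} {y : Sphere} (hy : y ∈ V) :
    branchDensity f V δ y = ENNReal.ofReal (sphDeriv f y) ^ δ := by
  simp [branchDensity, hy]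

lemma branchDensity_of_notMem {f : Sphere → Sphere} {V : Set Sphere} {y : Sphere} (hy : y ∉ V) :
    branchDensity f V δ y = 0 := by
  simp [branchDensity, hy]

lemma branchExtend_of_mem {f : Sphere → Sphere} {V : Set Sphere} {y : Sphere} (hy : y ∈ V) :
    branchExtend f V y = f y := by
  simp [branchExtend, hy]

/-- Near `f a`, for `a` in the limit set, a weak* limit is the transport by `f` of its multiple by
`|Df| ^ δ`. -/
lemma IsAdmissible.exists_nhds_measure_eq_map (hτ : F.IsAdmissible x δ τ) (hδ : 0 < δ)
    (hU : F.IsBranchDomain x U) {S : Set Sphere} (hS : IsClosed S)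
    (hF : F.InvariantlyInverseLike S) (hx : x ∈ S) (hsing : F.limitSet x ∩ F.sing = ∅)
    {μ : Measure Sphere} [IsFiniteMeasure μ]
    (hμ : IsWeakStarLimit (fun s => F.psMeasure x U (τ s)) δ μ)
    {V : Set Sphere} (hV : IsOpen V) {f : Sphere → Sphere} (hf : IsBranchOn F.image V f)
    {a : Sphere} (ha : a ∈ F.limitSet x) (haV : a ∈ V) :
    ∃ O, IsOpen O ∧ f a ∈ O ∧ ∀ B ⊆ O, MeasurableSet B →
      μ B = (μ.withDensity (branchDensity f V δ)).map (branchExtend f V) B := by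
  have hΛS := hF.limitSet_subset hS hx
  have hasing : a ∉ F.sing := fun h => (hsing ▸ ⟨ha, h⟩ : a ∈ (∅ : Set Sphere))
  have hcont : ∀ y ∈ V, ContinuousAt (sphDeriv f) y := fun y hy => continuousAt_sphDeriv <| by
    filter_upwards [hV.mem_nhds hy] with z hz using hf.conformalNear hz
  obtain ⟨C, hC, hCc, hCV⟩ := exists_mem_nhds_isClosed_subset (hV.mem_nhds haV)
  obtain ⟨C', hC', hC'c, hC'C⟩ := exists_mem_nhds_isClosed_subset (interior_mem_nhds.2 hC)
  -- `|Df|^δ (φ ∘ f)` is controlled only on `V`. The cut-off `χ` extends it continuously by zero,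
  -- and equals `1` on `C'`, hence on `W`.
  obtain ⟨χ, hχ0, hχ1, hχ⟩ := exists_continuous_zero_one_of_isClosed
    isOpen_interior.isClosed_compl hC'c (disjoint_compl_left_iff_subset.2 hC'C)
  obtain ⟨W, N, hW, hN, haW, hbN, hWsub, h1, h2⟩ := exists_nhds_branch hS hF (hΛS ha) hasing hV haV
    hf (W₁ := C' ∩ {y | sphDeriv f y < sphDeriv f a + 1}) (inter_mem hC'
      ((hcont a haV).eventually (gt_mem_nhds (lt_add_one _))))
  -- The cut-off integrand and the density are compared only on `S`, which contains `μ`-almost every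
  -- point.
  have hΛ : ∀ᵐ y ∂μ, y ∈ F.limitSet x := by
    filter_upwards [Measure.support_mem_ae (μ := μ)] with y hy
      using hτ.support_subset hδ hU hμ hy
  refine exists_nhds_measure_eq hN hbN fun φ hφ hφN => ?_
  classical
  set ψ₀ : Sphere → ℝ := fun y => if y ∈ V then χ y * (sphDeriv f y ^ δ * φ (f y)) else 0 with hψ₀
  have hψc : Continuous ψ₀ := by
    rw [continuous_iff_continuousAt]
    intro y
    by_cases hy : y ∈ V
    · have hc : ContinuousAt (fun y => χ y * (sphDeriv f y ^ δ * φ (f y))) y :=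
        χ.continuous.continuousAt.mul (((hcont y hy).rpow_const (.inr hδ.le)).mul
          (φ.continuous.continuousAt.comp (hf.conformalNear hy).continuousAt))
      refine hc.congr ?_
      filter_upwards [hV.mem_nhds hy] with z hz
      simp [hψ₀, hz]
    · have hc : ContinuousAt (fun _ : Sphere => (0 : ℝ)) y := continuousAt_const
      refine hc.congr ?_
      filter_upwards [hCc.isOpen_compl.mem_nhds fun h => hy (hCV h)] with z hz
      have : χ z = 0 := hχ0 fun h => hz (interior_subset h)
      simp [hψ₀, this]
  have hψ₀nn : ∀ y, 0 ≤ ψ₀ y := fun y => by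
    simp only [hψ₀]
    split_ifs
    · exact mul_nonneg (hχ y).1 (mul_nonneg (Real.rpow_nonneg (sphDeriv_nonneg _ _) _) (hφ _))
    · exact le_rfl
  have hψW : ∀ y ∈ W, ψ₀ y = sphDeriv f y ^ δ * φ (f y) := fun y hy => by
    have : χ y = 1 := hχ1 (hWsub hy).2.1
    simp [hψ₀, (hWsub hy).1, this]
  have hφS : ∀ y ∈ S \ W, y ∈ V → φ (f y) = 0 := fun y hy hyV =>
    hφN _ fun hyN => hy.2 (h1 y hy.1 _ (hf.2 y hyV) hyN)
  have hψS : ∀ y ∈ S \ W, ψ₀ y = 0 := fun y hy => by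
    by_cases hyV : y ∈ V
    · simp [hψ₀, hφS y hy hyV]
    · simp [hψ₀, hyV]
  have hm : Measurable fun y => ENNReal.ofReal (φ (branchExtend f V y)) :=
    φ.continuous.measurable.ennreal_ofReal.comp (measurable_branchExtend hV hf)
  rw [hτ.lintegral_eq hδ hU hF hx hV hf hW hN (fun y hy => (hWsub hy).1) h1 h2
    (K := sphDeriv f a + 1) (fun y hy => ((hWsub hy).2.2 : sphDeriv f y < _).le) hμ (φ := φ)
    (ψ := ⟨ψ₀, hψc⟩) hφ hψ₀nn hφN hψW hψS,
    lintegral_map φ.continuous.measurable.ennreal_ofReal (measurable_branchExtend hV hf),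
    lintegral_withDensity_eq_lintegral_mul _ (measurable_branchDensity hV hf δ) hm]
  refine lintegral_congr_ae ?_
  filter_upwards [hΛ] with y hy
  simp only [ContinuousMap.coe_mk, Pi.mul_apply]
  by_cases hyV : y ∈ V
  · rw [branchDensity_of_mem hyV, branchExtend_of_mem hyV]
    by_cases hyW : y ∈ W
    · rw [hψW y hyW, ENNReal.ofReal_mul (Real.rpow_nonneg (sphDeriv_nonneg _ _) _),
        ENNReal.ofReal_rpow_of_nonneg (sphDeriv_nonneg _ _) hδ.le]
    · rw [hψS y ⟨hΛS hy, hyW⟩, hφS y ⟨hΛS hy, hyW⟩ hyV]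
      simp
  · rw [branchDensity_of_notMem hyV]
    simp [hψ₀, hyV]

/-- Weak* limits for admissible families of exponents are conformal. -/
theorem IsAdmissible.isConformal (hτ : F.IsAdmissible x δ τ) (hδ : 0 < δ)
    (hU : F.IsBranchDomain x U) {S : Set Sphere} (hS : IsClosed S)
    (hF : F.InvariantlyInverseLike S) (hx : x ∈ S) (hsing : F.limitSet x ∩ F.sing = ∅)
    {μ : Measure Sphere} [IsFiniteMeasure μ]
    (hμ : IsWeakStarLimit (fun s => F.psMeasure x U (τ s)) δ μ) :
    F.IsConformal (F.limitSet x) δ μ := by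
  have hsupp := hτ.support_subset hδ hU hμ
  have hΛ : ∀ᵐ y ∂μ, y ∈ F.limitSet x := by
    filter_upwards [Measure.support_mem_ae (μ := μ)] with y hy using hsupp hy
  have hΛ0 : μ (F.limitSet x)ᶜ = 0 := hΛ
  refine ⟨?_, hsupp, ?_⟩
  · obtain ⟨l, hne, hl, hlim⟩ := hμ
    have h1 := hlim 1
    have h2 : Tendsto (fun s => ∫ z, (1 : C(Sphere, ℝ)) z ∂(F.psMeasure x U (τ s))) l (𝓝 1) := by
      refine tendsto_const_nhds.congr' ?_
      filter_upwards [hl (hτ.isProbabilityMeasure hU)] with s hs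
      have := hs
      simp
    have h3 := tendsto_nhds_unique h1 h2
    have h4 : μ.real univ = 1 := by simpa using h3
    exact ⟨by rw [← ENNReal.toReal_eq_one_iff]; exact h4⟩
  · rintro A f ⟨hA, -, ⟨V, hV, hAV, hf⟩, -, hAf⟩
    set Λ := F.limitSet x with hΛdef
    have hΛm : MeasurableSet Λ := (isClosed_limitSet F x).measurableSet
    have hΛS := hF.limitSet_subset hS hx
    set ν := (μ.withDensity (branchDensity f V δ)).map (branchExtend f V) with hν
    -- Since the limit set lies in `S`, injectivity on it is exactly inverse-likeness.
    have hinj : InjOn f (Λ ∩ V) := fun y hy z hz hyz =>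
      hF.eq_of_mem_image (hΛS hy.1) (hΛS hz.1) (hf.2 y hy.2) (hyz ▸ hf.2 z hz.2)
    have hloc : ∀ a : Sphere, ∃ O, a ∈ Λ ∩ V → IsOpen O ∧ f a ∈ O ∧
        ∀ B ⊆ O, MeasurableSet B → μ B = ν B := fun a => by
      by_cases ha : a ∈ Λ ∩ V
      · obtain ⟨O, hO⟩ := hτ.exists_nhds_measure_eq_map hδ hU hS hF hx hsing hμ hV hf ha.1 ha.2
        exact ⟨O, fun _ => hO⟩
      · exact ⟨∅, fun h => absurd h ha⟩
    choose O hO using hloc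
    -- By second countability, countably many of the local equalities cover `f (Λ ∩ V)`.
    obtain ⟨T, hT, hTO⟩ := TopologicalSpace.isOpen_iUnion_countable
      (fun a : ↥(Λ ∩ V) => O a) fun a => (hO a a.2).1
    have hres : μ.restrict (⋃ a ∈ T, O a) = ν.restrict (⋃ a ∈ T, O a) := by
      rw [Measure.restrict_biUnion_congr hT]
      intro a _
      have ha := hO a a.2
      refine Measure.ext fun B hB => ?_
      rw [Measure.restrict_apply hB, Measure.restrict_apply hB]
      exact ha.2.2 _ inter_subset_right (hB.inter ha.1.measurableSet)
    have hA' : MeasurableSet (A ∩ Λ) := hA.inter hΛm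
    have hB : MeasurableSet (f '' (A ∩ Λ)) := by
      refine hA'.image_of_continuousOn_injOn (fun y hy =>
        (hf.conformalNear (hAV hy.1)).continuousAt.continuousWithinAt) ?_
      exact hinj.mono (show A ∩ Λ ⊆ Λ ∩ V from fun y hy => ⟨hy.2, hAV hy.1⟩)
    have hBO : f '' (A ∩ Λ) ⊆ ⋃ a ∈ T, O a := by
      rw [hTO]
      rintro _ ⟨y, hy, rfl⟩
      exact mem_iUnion.2 ⟨⟨y, hy.2, hAV hy.1⟩, (hO y ⟨hy.2, hAV hy.1⟩).2.1⟩
    have hμν : μ (f '' (A ∩ Λ)) = ν (f '' (A ∩ Λ)) := by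
      rw [← Measure.restrict_eq_self μ hBO, hres, Measure.restrict_eq_self ν hBO]
    have hfm := measurable_branchExtend hV hf
    calc μ (f '' A) = μ (f '' (A ∩ Λ)) := by
          refine le_antisymm ?_ (measure_mono (image_mono inter_subset_left))
          -- The special-pair condition sends the part of `A` outside `Λ` into the null set `Λᶜ`.
          have hsub : f '' A ⊆ f '' (A ∩ Λ) ∪ Λᶜ := by
            rintro _ ⟨y, hy, rfl⟩
            by_cases hyΛ : y ∈ Λ
            · exact .inl ⟨y, ⟨hy, hyΛ⟩, rfl⟩
            · exact .inr fun h => (hAf ▸ ⟨⟨y, ⟨hy, hyΛ⟩, rfl⟩, h⟩ : f y ∈ (∅ : Set Sphere))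
          refine (measure_mono hsub).trans ((measure_union_le _ _).trans_eq ?_)
          rw [hΛ0, add_zero]
      _ = ν (f '' (A ∩ Λ)) := hμν
      _ = ∫⁻ y in branchExtend f V ⁻¹' (f '' (A ∩ Λ)), branchDensity f V δ y ∂μ := by
          rw [hν, Measure.map_apply hfm hB, withDensity_apply _ (hfm hB)]
      _ = ∫⁻ y in A, ENNReal.ofReal (sphDeriv f y) ^ δ ∂μ := by
          rw [← lintegral_indicator (hfm hB), ← lintegral_indicator hA]
          refine lintegral_congr_ae ?_
          filter_upwards [hΛ] with y hy
          by_cases hyV : y ∈ V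
          · have hiff : y ∈ branchExtend f V ⁻¹' (f '' (A ∩ Λ)) ↔ y ∈ A := by
              rw [mem_preimage, branchExtend_of_mem hyV]
              constructor
              · rintro ⟨z, hz, hzy⟩
                exact hinj ⟨hz.2, hAV hz.1⟩ ⟨hy, hyV⟩ hzy ▸ hz.1
              · exact fun h => ⟨y, ⟨h, hy⟩, rfl⟩
            by_cases hyA : y ∈ A
            · rw [indicator_of_mem (hiff.2 hyA), indicator_of_mem hyA, branchDensity_of_mem hyV]
            · rw [indicator_of_notMem fun h => hyA (hiff.1 h), indicator_of_notMem hyA]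
          · have : y ∉ A := fun h => hyV (hAV h)
            simp [branchDensity_of_notMem hyV, this]

/-- Weak* limits exist. -/
lemma IsAdmissible.exists_isWeakStarLimit (hτ : F.IsAdmissible x δ τ)
    (hU : F.IsBranchDomain x U) : ∃ μ : Measure Sphere, IsFiniteMeasure μ ∧
      IsWeakStarLimit (fun s => F.psMeasure x U (τ s)) δ μ := by
  classical
  -- The Dirac mass is a dummy value for parameters where the normalization fails; near `δ` it never
  -- occurs. Compactness of the space of probability measures gives a limit along an ultrafilter.
  set M : ℝ → ProbabilityMeasure Sphere := fun s =>
    if h : IsProbabilityMeasure (F.psMeasure x U (τ s)) then ⟨_, h⟩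
      else ⟨Measure.dirac OnePoint.infty, inferInstance⟩ with hM
  set l : Ultrafilter ℝ := Ultrafilter.of (𝓝[>] δ)
  have hl : (l : Filter ℝ) ≤ 𝓝[>] δ := Ultrafilter.of_le _
  obtain ⟨μ, -, hμ⟩ := isCompact_univ.ultrafilter_le_nhds (l.map M) (by simp)
  have hμ' : Tendsto M l (𝓝 μ) := hμ
  rw [ProbabilityMeasure.tendsto_iff_forall_integral_tendsto] at hμ'
  refine ⟨μ, inferInstance, l, inferInstance, hl, fun φ => ?_⟩
  refine (hμ' (BoundedContinuousFunction.mkOfCompact φ)).congr' ?_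
  filter_upwards [hl (hτ.isProbabilityMeasure hU)] with s hs
  have : (M s : Measure Sphere) = F.psMeasure x U (τ s) := by
    have : M s = ⟨_, hs⟩ := dif_pos hs
    rw [this]; rfl
  rw [this]
  rfl

/-! ### The critical exponent -/

/-- Convergence of the Poincaré series persists at larger exponents. -/
lemma tsum_levelSum_lt_top_of_le {s t : ℝ} (hs : 0 < s) (hst : s ≤ t)
    (h : ∑' n, F.levelSum x n s < ∞) : ∑' n, F.levelSum x n t < ∞ := by
  set P := ∑' n, F.levelSum x n s with hP
  -- Derivatives may exceed `1`, but convergence at `s` bounds them all by `P ^ (1 / s)`, so raising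
  -- the exponent costs a constant factor.
  have hle : ∀ n, F.levelSum x n t ≤ (P ^ (1 / s)) ^ (t - s) * F.levelSum x n s := by
    intro n
    rw [levelSum, levelSum, ← ENNReal.tsum_mul_left]
    refine ENNReal.tsum_le_tsum fun γ => ?_
    have h1 : germDeriv γ.1 ^ s ≤ P :=
      (ENNReal.le_tsum (f := fun γ : germBranches (F.iter n) x => germDeriv γ.1 ^ s) γ).trans
        (ENNReal.le_tsum (f := fun n => F.levelSum x n s) n)
    have h2 : germDeriv γ.1 ≤ P ^ (1 / s) := by
      rwa [one_div, ENNReal.le_rpow_inv_iff hs]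
    calc germDeriv γ.1 ^ t = germDeriv γ.1 ^ (t - s) * germDeriv γ.1 ^ s := by
          rw [← ENNReal.rpow_add_of_nonneg _ _ (sub_nonneg.2 hst) hs.le, sub_add_cancel]
      _ ≤ _ := by
          gcongr
  refine (ENNReal.tsum_le_tsum hle).trans_lt ?_
  rw [ENNReal.tsum_mul_left]
  exact ENNReal.mul_lt_top (ENNReal.rpow_lt_top_of_nonneg (sub_nonneg.2 hst)
    (ENNReal.rpow_lt_top_of_nonneg (by positivity) h.ne).ne) h

lemma IsBranchDomain.poincareSeries_eq_tsum (hU : F.IsBranchDomain x U) (s : ℝ) :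
    F.poincareSeries x s = ∑' n, F.levelSum x n s := by
  rw [hU.poincareSeries_eq, germSum_one]

lemma exists_isBranchDomain {s : ℝ} (h : F.poincareSeries x s < ∞) :
    ∃ U, F.IsBranchDomain x U := by
  obtain ⟨U, hU⟩ := iInf_lt_iff.1 h
  obtain ⟨hU, -⟩ := iInf_lt_iff.1 hU
  exact ⟨U, hU⟩

end Correspondence

end AlgCorr

end

theorem mainTheorem6 (F : AlgCorr.Correspondence) (S : Set AlgCorr.Sphere) (hS : IsClosed S)
    (hF : F.InvariantlyInverseLike S) (x : AlgCorr.Sphere) (hx : x ∈ S)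
    (hpos : 0 < F.critExponent x) (hfin : F.critExponent x < ∞)
    (hsing : F.limitSet x ∩ F.sing = ∅) (δ : ℝ) (hδ : δ = (F.critExponent x).toReal) :
    -- there is a conformal measure
    (∃ μ : Measure AlgCorr.Sphere, F.IsConformal (F.limitSet x) δ μ) ∧
    -- divergence of the Poincaré series at the critical exponent: the measures `μ_s`
    (Tendsto (F.poincareSeries x) (𝓝[>] δ) (𝓝 ∞) →
      ∀ U : Set AlgCorr.Sphere, F.IsBranchDomain x U →
        (∀ᶠ s in 𝓝[>] δ, IsProbabilityMeasure (F.psMeasure x U fun _ => s)) ∧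
        ∀ μ : Measure AlgCorr.Sphere, IsFiniteMeasure μ →
          AlgCorr.IsWeakStarLimit (fun s => F.psMeasure x U fun _ => s) δ μ →
          F.IsConformal (F.limitSet x) δ μ) ∧
    -- otherwise: the modified measures, for suitable `h` growing as quickly as one likes
    (¬ Tendsto (F.poincareSeries x) (𝓝[>] δ) (𝓝 ∞) →
      ∀ h₀ : ℝ → ℝ, ∃ h : ℝ → ℝ, (∀ r, h₀ r ≤ h r) ∧
        ∀ U : Set AlgCorr.Sphere, F.IsBranchDomain x U →
          Tendsto (fun s => F.weightedSeries x U (AlgCorr.modifiedExponent h δ s))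
            (𝓝[>] δ) (𝓝 ∞) ∧
          (∀ᶠ s in 𝓝[>] δ,
            IsProbabilityMeasure (F.psMeasure x U (AlgCorr.modifiedExponent h δ s))) ∧
          ∀ μ : Measure AlgCorr.Sphere, IsFiniteMeasure μ →
            AlgCorr.IsWeakStarLimit
              (fun s => F.psMeasure x U (AlgCorr.modifiedExponent h δ s)) δ μ →
            F.IsConformal (F.limitSet x) δ μ) := by
  open AlgCorr AlgCorr.Correspondence in
  have hδ0 : 0 < δ := hδ ▸ ENNReal.toReal_pos hpos.ne' hfin.ne
  have hcrit : F.critExponent x = ENNReal.ofReal δ := by rw [hδ, ENNReal.ofReal_toReal hfin.ne]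
  obtain ⟨U₀, hU₀⟩ : ∃ U, F.IsBranchDomain x U := by
    obtain ⟨_, ⟨s, ⟨-, hs⟩, rfl⟩, -⟩ := sInf_lt_iff.1 hfin
    exact exists_isBranchDomain hs
  have hP : F.poincareSeries x = fun s => ∑' n, F.levelSum x n s :=
    funext hU₀.poincareSeries_eq_tsum
  have hbelow : ∀ t, 0 < t → t < δ → ∑' n, F.levelSum x n t = ∞ := by
    intro t ht htδ
    by_contra hne
    have hmem : F.critExponent x ≤ ENNReal.ofReal t :=
      sInf_le ⟨t, ⟨ht, by rw [hP]; exact lt_top_iff_ne_top.2 hne⟩, rfl⟩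
    rw [hcrit] at hmem
    exact absurd ((ENNReal.ofReal_le_ofReal_iff ht.le).1 hmem) (not_le.2 htδ)
  have habove : ∀ s, δ < s → ∑' n, F.levelSum x n s < ∞ := by
    intro s hs
    have h1 : F.critExponent x < ENNReal.ofReal s := by
      rw [hcrit]; exact (ENNReal.ofReal_lt_ofReal_iff (hδ0.trans hs)).2 hs
    obtain ⟨_, ⟨s', ⟨hs'0, hs'⟩, rfl⟩, hlt⟩ := sInf_lt_iff.1 h1
    rw [hP] at hs'
    exact tsum_levelSum_lt_top_of_le hs'0
      ((ENNReal.ofReal_lt_ofReal_iff (hδ0.trans hs)).1 hlt).le hs'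
  have hdivergent : Tendsto (F.poincareSeries x) (𝓝[>] δ) (𝓝 ∞) →
      F.IsAdmissible x δ fun s _ => s := fun h =>
    isAdmissible_const (by filter_upwards [self_mem_nhdsWithin] with s hs using habove s hs)
      (by rwa [hP] at h)
  have hmodified : ¬ Tendsto (F.poincareSeries x) (𝓝[>] δ) (𝓝 ∞) → ∀ h₀ : ℝ → ℝ,
      ∃ h : ℝ → ℝ, (∀ r, h₀ r ≤ h r) ∧ F.IsAdmissible x δ (modifiedExponent h δ) := by
    intro h h₀
    -- Failure of divergence bounds the series only for some `s` arbitrarily close to `δ`. Fatou's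
    -- lemma gives convergence at `δ`, and domination by the series at `δ` and `2δ` then bounds it
    -- for all nearby `s`.
    obtain ⟨C, hC⟩ : ∃ C : NNReal, ∃ᶠ s in 𝓝[>] δ, ∑' n, F.levelSum x n s ≤ C := by
      rw [ENNReal.tendsto_nhds_top_iff_nnreal] at h
      push Not at h
      obtain ⟨C, hC⟩ := h
      exact ⟨C, by simpa [hP] using hC⟩
    have hδfin : ∑' n, F.levelSum x n δ < ∞ :=
      (tsum_levelSum_le_of_frequently x hδ0 hC).trans_lt ENNReal.coe_lt_top
    refine hU₀.exists_isAdmissible_modifiedExponent hδ0 hδfin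
      (C := ∑' n, F.levelSum x n δ + ∑' n, F.levelSum x n (2 * δ))
      (ENNReal.add_lt_top.2 ⟨hδfin, habove _ (by linarith)⟩).ne ?_ hbelow h₀
    filter_upwards [Ioo_mem_nhdsGT (show δ < 2 * δ by linarith)] with s hs
    exact tsum_levelSum_le_add x hs.1.le hs.2.le
  refine ⟨?_, fun h U hU => ?_, fun h h₀ => ?_⟩
  · obtain ⟨τ, hτ⟩ : ∃ τ, F.IsAdmissible x δ τ := by
      by_cases h : Tendsto (F.poincareSeries x) (𝓝[>] δ) (𝓝 ∞)
      · exact ⟨_, hdivergent h⟩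
      · obtain ⟨h', -, hτ⟩ := hmodified h fun _ => 0
        exact ⟨_, hτ⟩
    obtain ⟨μ, hμ, hlim⟩ := hτ.exists_isWeakStarLimit hU₀
    exact ⟨μ, hτ.isConformal hδ0 hU₀ hS hF hx hsing hlim⟩
  · have hτ := hdivergent h
    exact ⟨hτ.isProbabilityMeasure hU, fun μ _ hμ => hτ.isConformal hδ0 hU hS hF hx hsing hμ⟩
  · obtain ⟨h', hh, hτ⟩ := hmodified h h₀
    refine ⟨h', hh, fun U hU => ⟨?_, hτ.isProbabilityMeasure hU,
      fun μ _ hμ => hτ.isConformal hδ0 hU hS hF hx hsing hμ⟩⟩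
    simp only [hU.weightedSeries_eq, germSum_one]
    exact hτ.diverges
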